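/- Let $K$ be a field, let $N=\mathbb Z^n$ and $M=\operatorname{Hom}(N,\mathbb Z)$, and let $\Sigma$ be a simplicial complete fan in $N_{\mathbb R}=\mathbb R^n$ (a nonempty finite set of strongly convex rational polyhedral cones, closed under taking faces, any two of which meet along a common face, such that every $k$-dimensional cone is generated by exactly $k$ one-dimensional cones of $\Sigma$, and whose cones cover $\mathbb R^n$). Let $X_\Sigma$ be the split toric variety over $K$ defined by $\Sigma$, i.e. the gluing of the affine charts $\operatorname{Spec}K[\sigma^\vee\cap M]$, $\sigma\in\Sigma$. Let $\Sigma(k)$ denote the set of $k$-dimensional cones of $\Sigma$, let $\sigma(1)$ be the set of one-dimensional cones $\rho\in\Sigma(1)$ contained in $\sigma$, and let $D_\rho\subset X_\Sigma$ be the torus-invariant prime divisor of $\rho\in\Sigma(1)$. Let $D$ be an effective Weil divisor on $X_\Sigma$. Assume that at least one of the following conditions holds: 1. $D$ is not nef (i.e. it is not the case that $D\cdot C\ge 0$ for every complete integral curve $C\subset X_\Sigma$; intersection numbers make sense since $D$ is $\mathbb Q$-Cartier); 2. the order of the torsion subgroup of the class group $\operatorname{Cl}(X_\Sigma)$ is prime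 to the characteristic of $K$ (no condition if the characteristic is $0$), and $D$ is not a Cartier divisor. Then there is a cone $\sigma\in\Sigma(n)$ such that the torus-invariant point $$\gamma_\sigma=\bigcap_{\rho\in\sigma(1)}D_\rho$$ lies in the support of $D$. In particular $D$ contains a point that is rational over $\mathbb Z$: the point $\gamma_\sigma$ is the image of the $K$-point of $X_\Sigma$ induced, through $\mathbb Z\to K$, by a $\mathbb Z$-point of the toric scheme over $\mathbb Z$ defined by $\Sigma$ (the gluing of the $\operatorname{Spec}\mathbb Z[\sigma^\vee\cap M]$). -/

import Mathlib

open CategoryTheory CategoryTheory.Limits AlgebraicGeometry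

universe u

noncomputable section

/-! ## Fans -/

/-- The pairing of the character `m ∈ M = ℤⁿ` with a vector `v ∈ N_ℝ = ℝⁿ`. -/
def latticePairing {n : ℕ} (m : Fin n → ℤ) (v : Fin n → ℝ) : ℝ := ∑ i, (m i : ℝ) * v i

/-- `τ` is a face of the (rational polyhedral) cone `σ`: it is cut out by a supporting hyperplane
`m^⊥` of `σ`, with `m` in the lattice of characters. -/
def IsConeFace {n : ℕ} (τ σ : PointedCone ℝ (Fin n → ℝ)) : Prop :=
  ∃ m : Fin n → ℤ, (∀ v ∈ σ, 0 ≤ latticePairing m v) ∧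
    ∀ v, v ∈ τ ↔ v ∈ σ ∧ latticePairing m v = 0

/-- The semigroup `σ^∨ ∩ M` of lattice points of the dual cone. -/
def dualMonoid {n : ℕ} (σ : PointedCone ℝ (Fin n → ℝ)) : AddSubmonoid (Fin n → ℤ) where
  carrier := {m | ∀ v ∈ σ, 0 ≤ latticePairing m v}
  zero_mem' := by intro v _; simp [latticePairing]
  add_mem' := by
    intro a b ha hb v hv
    have : latticePairing (a + b) v = latticePairing a v + latticePairing b v := by
      simp [latticePairing, add_mul, Finset.sum_add_distrib]
    rw [this]; exact add_nonneg (ha v hv) (hb v hv)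

/-- A fan in `N_ℝ = ℝⁿ`, with respect to the lattice `N = ℤⁿ`: a nonempty finite collection of
strongly convex rational polyhedral cones, closed under taking faces, any two of which meet along
a common face. -/
structure ToricFan (n : ℕ) where
  cones : Set (PointedCone ℝ (Fin n → ℝ))
  finite_cones : cones.Finite
  nonempty_cones : cones.Nonempty
  rational : ∀ σ ∈ cones, ∃ s : Finset (Fin n → ℤ),
    σ = PointedCone.hull ℝ ((fun (w : Fin n → ℤ) (i : Fin n) => (w i : ℝ)) '' (s : Set (Fin n → ℤ)))
  strongly_convex : ∀ σ ∈ cones, ∀ v ∈ σ, -v ∈ σ → v = 0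
  face_mem : ∀ σ ∈ cones, ∀ τ, IsConeFace τ σ → τ ∈ cones
  inter_face : ∀ σ ∈ cones, ∀ τ ∈ cones, IsConeFace (σ ⊓ τ) σ

/-- The dimension of a cone: the dimension of its linear span. -/
def coneDim {n : ℕ} (σ : PointedCone ℝ (Fin n → ℝ)) : ℕ :=
  Module.finrank ℝ (Submodule.span ℝ (σ : Set (Fin n → ℝ)))

namespace ToricFan

variable {n : ℕ} (Δ : ToricFan n)

/-- `Δ(k)`, the set of `k`-dimensional cones of the fan. -/
def conesOfDim (k : ℕ) : Set (PointedCone ℝ (Fin n → ℝ)) := {σ | σ ∈ Δ.cones ∧ coneDim σ = k}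

/-- `σ(1)`, the set of one-dimensional cones of the fan contained in `σ`. -/
def raysOf (σ : PointedCone ℝ (Fin n → ℝ)) : Set (PointedCone ℝ (Fin n → ℝ)) :=
  {ρ | ρ ∈ Δ.conesOfDim 1 ∧ ρ ≤ σ}

/-- The fan is simplicial: each `k`-dimensional cone is generated by exactly `k` one-dimensional
cones. -/
def IsSimplicial : Prop :=
  ∀ σ ∈ Δ.cones, sSup (Δ.raysOf σ) = σ ∧ (Δ.raysOf σ).ncard = coneDim σ

/-- The fan is complete: its cones cover the whole space. -/
def IsComplete : Prop := ∀ v : Fin n → ℝ, ∃ σ ∈ Δ.cones, v ∈ σ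

end ToricFan

/-! ### Auxiliary facts on cones -/

lemma latticePairing_add_left {n : ℕ} (a b : Fin n → ℤ) (v : Fin n → ℝ) :
    latticePairing (a + b) v = latticePairing a v + latticePairing b v := by
  simp [latticePairing, add_mul, Finset.sum_add_distrib]

lemma latticePairing_nsmul_left {n : ℕ} (k : ℕ) (a : Fin n → ℤ) (v : Fin n → ℝ) :
    latticePairing (k • a) v = k * latticePairing a v := by
  simp [latticePairing, Finset.mul_sum, mul_assoc]

lemma latticePairing_add_right {n : ℕ} (a : Fin n → ℤ) (v w : Fin n → ℝ) :
    latticePairing a (v + w) = latticePairing a v + latticePairing a w := by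
  simp [latticePairing, mul_add, Finset.sum_add_distrib]

lemma latticePairing_smul_right {n : ℕ} (a : Fin n → ℤ) (c : ℝ) (v : Fin n → ℝ) :
    latticePairing a (c • v) = c * latticePairing a v := by
  simp only [latticePairing, Finset.mul_sum, Pi.smul_apply, smul_eq_mul]
  exact Finset.sum_congr rfl fun i _ => by ring

lemma latticePairing_zero_right {n : ℕ} (a : Fin n → ℤ) : latticePairing a 0 = 0 := by
  simp [latticePairing]

lemma latticePairing_intCast {n : ℕ} (a w : Fin n → ℤ) :
    latticePairing a (fun i => (w i : ℝ)) = ((∑ i, a i * w i : ℤ) : ℝ) := by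
  simp [latticePairing]

lemma mem_dualMonoid {n : ℕ} {σ : PointedCone ℝ (Fin n → ℝ)} {m : Fin n → ℤ} :
    m ∈ dualMonoid σ ↔ ∀ v ∈ σ, 0 ≤ latticePairing m v := Iff.rfl

lemma dualMonoid_anti {n : ℕ} {τ σ : PointedCone ℝ (Fin n → ℝ)} (h : τ ≤ σ) :
    dualMonoid σ ≤ dualMonoid τ := fun _ hm v hv => hm v (h hv)

/-- Membership in the dual monoid can be checked on generators. -/
lemma mem_dualMonoid_hull {n : ℕ} {s : Finset (Fin n → ℤ)} {m : Fin n → ℤ} :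
    m ∈ dualMonoid (PointedCone.hull ℝ
      ((fun (w : Fin n → ℤ) (i : Fin n) => (w i : ℝ)) '' (s : Set (Fin n → ℤ)))) ↔
      ∀ w ∈ s, 0 ≤ ∑ i, m i * w i := by
  constructor
  · intro h w hw
    have := h _ (Submodule.subset_span (Set.mem_image_of_mem _ hw))
    rw [latticePairing_intCast] at this
    exact_mod_cast this
  · intro h v hv
    induction hv using Submodule.span_induction with
    | mem x hx =>
      obtain ⟨w, hw, rfl⟩ := hx
      rw [latticePairing_intCast]
      exact_mod_cast h w hw
    | zero => rw [latticePairing_zero_right]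
    | add x y _ _ hx hy => rw [latticePairing_add_right]; exact add_nonneg hx hy
    | smul c x _ hx =>
      have : c • x = (c : ℝ) • x := rfl
      rw [this, latticePairing_smul_right]; exact mul_nonneg c.2 hx

/-- The semigroup of lattice points of the dual of a rational polyhedral cone is finitely
generated. -/
lemma dualMonoid_fg {n : ℕ} {σ : PointedCone ℝ (Fin n → ℝ)} {s : Finset (Fin n → ℤ)}
    (hσ : σ = PointedCone.hull ℝ
      ((fun (w : Fin n → ℤ) (i : Fin n) => (w i : ℝ)) '' (s : Set (Fin n → ℤ)))) :
    (dualMonoid σ).FG := by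
  let A := (Fin n ⊕ Fin n ⊕ s) → ℕ
  let d : A →+ (Fin n → ℤ) :=
    { toFun := fun a i => (a (.inl i) : ℤ) - a (.inr (.inl i))
      map_zero' := by ext; simp
      map_add' := by
        intro a b; ext i
        change ((a _ + b _ : ℕ) : ℤ) - ((a _ + b _ : ℕ) : ℤ) = _
        push_cast; simp only [Pi.add_apply]; ring }
  let f : A →+ (s → ℤ) :=
    { toFun := fun a w => ∑ i, d a i * w.1 i
      map_zero' := by ext; simp
      map_add' := by intro a b; ext w; simp [add_mul, Finset.sum_add_distrib] }
  let g : A →+ (s → ℤ) :=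
    { toFun := fun a w => (a (.inr (.inr w)) : ℤ)
      map_zero' := by ext; simp
      map_add' := by
        intro a b; ext w
        change ((a _ + b _ : ℕ) : ℤ) = _
        push_cast; rfl }
  have hfg : (f.eqLocusM g).FG := AddSubmonoid.fg_eqLocusM f g
  have : dualMonoid σ = (f.eqLocusM g).map d := by
    ext m
    subst hσ
    rw [mem_dualMonoid_hull, AddSubmonoid.mem_map]
    constructor
    · intro h
      have hd : d (Sum.elim (fun i => (m i).toNat) (Sum.elim (fun i => (-m i).toNat)
          (fun w => (∑ i, m i * w.1 i).toNat))) = m := by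
        ext i
        simp only [d, AddMonoidHom.coe_mk, ZeroHom.coe_mk, Sum.elim_inl, Sum.elim_inr]
        omega
      refine ⟨_, ?_, hd⟩
      change f _ = g _
      ext w
      simp only [f, g, AddMonoidHom.coe_mk, ZeroHom.coe_mk, hd, Sum.elim_inr]
      rw [Int.toNat_of_nonneg (h w.1 w.2)]
    · rintro ⟨a, ha, rfl⟩ w hw
      have h2 : f a = g a := ha
      have := congrFun h2 ⟨w, hw⟩
      simp only [f, g, AddMonoidHom.coe_mk, ZeroHom.coe_mk] at this
      rw [this]; positivity
  rw [this]
  exact hfg.map d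

/-- If `τ = σ ∩ m^⊥` is a face, then `S_τ = S_σ + ℕ (-m)`. -/
lemma exists_nsmul_add_mem {n : ℕ} {τ σ : PointedCone ℝ (Fin n → ℝ)} {s : Finset (Fin n → ℤ)}
    (hσ : σ = PointedCone.hull ℝ
      ((fun (w : Fin n → ℤ) (i : Fin n) => (w i : ℝ)) '' (s : Set (Fin n → ℤ))))
    {m : Fin n → ℤ} (hm : ∀ v ∈ σ, 0 ≤ latticePairing m v)
    (hτ : ∀ v, v ∈ τ ↔ v ∈ σ ∧ latticePairing m v = 0) {a : Fin n → ℤ} (ha : a ∈ dualMonoid τ) :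
    ∃ k : ℕ, k • m + a ∈ dualMonoid σ := by
  subst hσ
  refine ⟨∑ w ∈ s, (∑ i, a i * w i).natAbs, mem_dualMonoid_hull.2 fun w hw => ?_⟩
  have hm' := mem_dualMonoid_hull.1 hm w hw
  have hsplit : ∀ k : ℕ, ∑ i, ((k • m + a) i) * w i =
      (k : ℤ) * (∑ i, m i * w i) + ∑ i, a i * w i := by
    intro k
    rw [Finset.mul_sum, ← Finset.sum_add_distrib]
    refine Finset.sum_congr rfl fun i _ => ?_
    rw [Pi.add_apply, Pi.smul_apply, nsmul_eq_mul]; ring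
  rw [hsplit]
  rcases hm'.eq_or_lt with h0 | h1
  · rw [← h0]
    have hw' : (fun i => (w i : ℝ)) ∈ τ := by
      refine (hτ _).2 ⟨Submodule.subset_span (Set.mem_image_of_mem _ hw), ?_⟩
      rw [latticePairing_intCast, ← h0]; simp
    have := ha _ hw'
    rw [latticePairing_intCast] at this
    have h3 : 0 ≤ ∑ i, a i * w i := by exact_mod_cast this
    simpa using h3
  · have h2 : (∑ i, a i * w i).natAbs ≤ ∑ w ∈ s, (∑ i, a i * w i).natAbs :=
      Finset.single_le_sum (f := fun w : Fin n → ℤ => (∑ i, a i * w i).natAbs)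
        (fun _ _ => Nat.zero_le _) hw
    have h4 : ((∑ i, a i * w i).natAbs : ℤ) ≤ ((∑ w ∈ s, (∑ i, a i * w i).natAbs : ℕ) : ℤ) := by
      exact_mod_cast h2
    have h5 := neg_abs_le (∑ i, a i * w i)
    rw [Int.natCast_natAbs] at h4
    nlinarith [abs_nonneg (∑ i, a i * w i)]

/-! ## The toric variety of a fan -/

/-- The coordinate ring `R[σ^∨ ∩ M]` of the affine toric scheme of the cone `σ`. -/
abbrev ConeRing {n : ℕ} (R : Type u) [CommRing R] (σ : PointedCone ℝ (Fin n → ℝ)) : Type u :=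
  AddMonoidAlgebra R (dualMonoid σ)

/-- The inclusion `R[σ^∨ ∩ M] → R[τ^∨ ∩ M]` for `τ ⊆ σ`. -/
def coneRingMap {n : ℕ} (R : Type u) [CommRing R] {τ σ : PointedCone ℝ (Fin n → ℝ)} (h : τ ≤ σ) :
    ConeRing R σ →+* ConeRing R τ :=
  AddMonoidAlgebra.mapDomainRingHom R (AddSubmonoid.inclusion (dualMonoid_anti h))

/-- The character `χ^m`, as a function on the affine toric scheme of the cone `σ`. -/
def coneChar {n : ℕ} (R : Type u) [CommRing R] {σ : PointedCone ℝ (Fin n → ℝ)} (m : dualMonoid σ) :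
    ConeRing R σ := AddMonoidAlgebra.single m 1

lemma coneRingMap_injective {n : ℕ} (R : Type u) [CommRing R] {τ σ : PointedCone ℝ (Fin n → ℝ)}
    (h : τ ≤ σ) : Function.Injective (coneRingMap R h) :=
  AddMonoidAlgebra.mapDomain_injective (AddSubmonoid.inclusion_injective _)

lemma coneRingMap_single {n : ℕ} (R : Type u) [CommRing R] {τ σ : PointedCone ℝ (Fin n → ℝ)}
    (h : τ ≤ σ) (m : dualMonoid σ) (r : R) :
    coneRingMap R h (AddMonoidAlgebra.single m r) =
      AddMonoidAlgebra.single (AddSubmonoid.inclusion (dualMonoid_anti h) m) r := by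
  simp [coneRingMap]

/-- For a face `τ = σ ∩ m^⊥`, the ring of `τ` is the localization of that of `σ` at `χ^m`. -/
lemma coneRingMap_isLocalization {n : ℕ} (R : Type u) [CommRing R]
    {τ σ : PointedCone ℝ (Fin n → ℝ)} (h : τ ≤ σ) {s : Finset (Fin n → ℤ)}
    (hσ : σ = PointedCone.hull ℝ
      ((fun (w : Fin n → ℤ) (i : Fin n) => (w i : ℝ)) '' (s : Set (Fin n → ℤ))))
    {m : Fin n → ℤ} (hm : m ∈ dualMonoid σ)
    (hτ : ∀ v, v ∈ τ ↔ v ∈ σ ∧ latticePairing m v = 0) :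
    letI := (coneRingMap R h).toAlgebra
    IsLocalization.Away (coneChar R ⟨m, hm⟩) (ConeRing R τ) := by
  let _ := (coneRingMap R h).toAlgebra
  have hmap : ∀ x, algebraMap (ConeRing R σ) (ConeRing R τ) x = coneRingMap R h x := fun _ => rfl
  have hneg : -m ∈ dualMonoid τ := by
    intro v hv
    have : latticePairing (-m) v = - latticePairing m v := by simp [latticePairing]
    rw [this, ((hτ v).1 hv).2]; simp
  have hpow : ∀ k : ℕ, coneRingMap R h (coneChar R ⟨m, hm⟩ ^ k) =
      AddMonoidAlgebra.single (k • ⟨m, dualMonoid_anti h hm⟩ : dualMonoid τ) 1 := by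
    intro k
    simp [coneChar, AddMonoidAlgebra.single_pow, coneRingMap_single]
    rfl
  have hunit : IsUnit (coneRingMap R h (coneChar R ⟨m, hm⟩)) := by
    refine IsUnit.of_mul_eq_one (AddMonoidAlgebra.single ⟨-m, hneg⟩ 1) ?_
    simp only [coneChar, coneRingMap_single, AddMonoidAlgebra.single_mul_single, mul_one]
    rw [AddMonoidAlgebra.one_def]
    congr 1
    ext i
    simp
  refine IsLocalization.Away.mk _ hunit ?_ ?_
  · intro x
    induction x using AddMonoidAlgebra.induction_linear with
    | zero => exact ⟨0, 0, by simp⟩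
    | add x y hx hy =>
      obtain ⟨k, a, ha⟩ := hx
      obtain ⟨l, b, hb⟩ := hy
      refine ⟨k + l, coneChar R ⟨m, hm⟩ ^ l * a + coneChar R ⟨m, hm⟩ ^ k * b, ?_⟩
      rw [map_add, map_mul, map_mul, map_pow, map_pow, ← ha, ← hb]
      ring
    | single a r =>
      obtain ⟨k, hk⟩ := exists_nsmul_add_mem hσ hm hτ a.2
      refine ⟨k, AddMonoidAlgebra.single ⟨k • m + a, hk⟩ r, ?_⟩
      rw [← map_pow, hmap, hmap, hpow, coneRingMap_single, AddMonoidAlgebra.single_mul_single]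
      congr 1
      · ext i; simp; ring
      · simp
  · intro a b hab
    exact ⟨0, by simpa using coneRingMap_injective R h hab⟩

namespace ToricFan

variable {n : ℕ} (Δ : ToricFan n)

/-- The poset of cones of the fan, ordered by inclusion (equivalently, by the face relation). -/
abbrev ConeIndex : Type := {σ : PointedCone ℝ (Fin n → ℝ) // σ ∈ Δ.cones}

lemma isConeFace_of_le {τ σ : PointedCone ℝ (Fin n → ℝ)} (hτ : τ ∈ Δ.cones) (hσ : σ ∈ Δ.cones)
    (h : τ ≤ σ) : IsConeFace τ σ := by
  have := Δ.inter_face σ hσ τ hτ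
  rwa [inf_eq_right.2 h] at this

/-- The diagram of affine toric schemes `U_σ = Spec R[σ^∨ ∩ M]`. -/
def chartDiagram (R : Type u) [CommRing R] : Δ.ConeIndex ⥤ Scheme.{u} where
  obj σ := Spec (CommRingCat.of (ConeRing R σ.1))
  map f := Spec.map (CommRingCat.ofHom (coneRingMap R f.le))
  map_id σ := by
    have : coneRingMap R (le_refl σ.1) = RingHom.id _ := by
      refine RingHom.ext fun x => ?_
      induction x using AddMonoidAlgebra.induction_linear with
      | zero => simp
      | add x y hx hy => rw [map_add, hx, hy, map_add]
      | single a r => rw [coneRingMap_single]; rfl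
    change Spec.map (CommRingCat.ofHom (coneRingMap R (le_refl σ.1))) = _
    rw [this]; exact Spec.map_id _
  map_comp {a b c} f g := by
    have : coneRingMap R (f.le.trans g.le) = (coneRingMap R f.le).comp (coneRingMap R g.le) := by
      refine RingHom.ext fun x => ?_
      induction x using AddMonoidAlgebra.induction_linear with
      | zero => simp
      | add x y hx hy => rw [map_add, hx, hy, map_add]
      | single a r => rw [RingHom.comp_apply, coneRingMap_single, coneRingMap_single,
          coneRingMap_single]; rfl
    change Spec.map (CommRingCat.ofHom (coneRingMap R (f.le.trans g.le))) = _
    rw [this, CommRingCat.ofHom_comp, Spec.map_comp]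

instance chartDiagram_isOpenImmersion (R : Type u) [CommRing R] {τ σ : Δ.ConeIndex} (f : τ ⟶ σ) :
    IsOpenImmersion ((Δ.chartDiagram R).map f) := by
  obtain ⟨m, hm, hτ⟩ := Δ.isConeFace_of_le τ.2 σ.2 f.le
  obtain ⟨s, hs⟩ := Δ.rational σ.1 σ.2
  let _ := (coneRingMap R f.le).toAlgebra
  have := coneRingMap_isLocalization R f.le hs (m := m) hm hτ
  exact IsOpenImmersion.of_isLocalization (coneChar R ⟨m, hm⟩)

lemma range_chartDiagram_map (R : Type u) [CommRing R] {τ σ : Δ.ConeIndex} (f : τ ⟶ σ)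
    {m : Fin n → ℤ} (hm : m ∈ dualMonoid σ.1)
    (hτ : ∀ v, v ∈ τ.1 ↔ v ∈ σ.1 ∧ latticePairing m v = 0) :
    Set.range ((Δ.chartDiagram R).map f) =
      (PrimeSpectrum.basicOpen (coneChar R ⟨m, hm⟩) : Set (PrimeSpectrum (ConeRing R σ.1))) := by
  obtain ⟨s, hs⟩ := Δ.rational σ.1 σ.2
  let _ := (coneRingMap R f.le).toAlgebra
  have := coneRingMap_isLocalization R f.le hs (m := m) hm hτ
  exact PrimeSpectrum.localization_away_comap_range (ConeRing R τ.1) (coneChar R ⟨m, hm⟩)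

instance chartDiagram_isLocallyDirected (R : Type u) [CommRing R] :
    (Δ.chartDiagram R ⋙ Scheme.forget).IsLocallyDirected := by
  refine ⟨fun {i j k} fi fj xi xj hx => ?_⟩
  obtain ⟨a, ha, hia⟩ := Δ.isConeFace_of_le i.2 k.2 fi.le
  obtain ⟨b, hb, hjb⟩ := Δ.isConeFace_of_le j.2 k.2 fj.le
  have hmem : i.1 ⊓ j.1 ∈ Δ.cones := Δ.face_mem i.1 i.2 _ (Δ.inter_face i.1 i.2 j.1 j.2)
  let l : Δ.ConeIndex := ⟨i.1 ⊓ j.1, hmem⟩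
  let fli : l ⟶ i := homOfLE (inf_le_left : i.1 ⊓ j.1 ≤ i.1)
  let flj : l ⟶ j := homOfLE (inf_le_right : i.1 ⊓ j.1 ≤ j.1)
  have hab : a + b ∈ dualMonoid k.1 := (dualMonoid k.1).add_mem ha hb
  have hlk : ∀ v, v ∈ l.1 ↔ v ∈ k.1 ∧ latticePairing (a + b) v = 0 := by
    intro v
    rw [latticePairing_add_left]
    constructor
    · intro hv
      have h1 := (hia v).1 (show v ∈ i.1 from hv.1)
      have h2 := (hjb v).1 (show v ∈ j.1 from hv.2)
      exact ⟨h1.1, by rw [h1.2, h2.2, add_zero]⟩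
    · rintro ⟨hv, h0⟩
      have h1 := ha v hv
      have h2 := hb v hv
      exact ⟨(hia v).2 ⟨hv, by linarith⟩, (hjb v).2 ⟨hv, by linarith⟩⟩
  have hx' : (Δ.chartDiagram R).map fi xi = (Δ.chartDiagram R).map fj xj := hx
  have h1 : (Δ.chartDiagram R).map fi xi ∈ Set.range ((Δ.chartDiagram R).map (fli ≫ fi)) := by
    rw [Δ.range_chartDiagram_map R (fli ≫ fi) hab hlk]
    have hA : (Δ.chartDiagram R).map fi xi ∈ Set.range ((Δ.chartDiagram R).map fi) := ⟨xi, rfl⟩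
    have hB : (Δ.chartDiagram R).map fi xi ∈ Set.range ((Δ.chartDiagram R).map fj) :=
      ⟨xj, hx'.symm⟩
    rw [Δ.range_chartDiagram_map R fi ha hia] at hA
    rw [Δ.range_chartDiagram_map R fj hb hjb] at hB
    have hmul : coneChar R (⟨a + b, hab⟩ : dualMonoid k.1) =
        coneChar R ⟨a, ha⟩ * coneChar R ⟨b, hb⟩ := by
      simp only [coneChar, AddMonoidAlgebra.single_mul_single, mul_one]
      rfl
    rw [hmul, PrimeSpectrum.basicOpen_mul]
    exact ⟨hA, hB⟩
  obtain ⟨z, hz⟩ := h1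
  refine ⟨l, fli, flj, z, ?_, ?_⟩
  · apply ((Δ.chartDiagram R).map fi).isOpenEmbedding.injective
    rw [← hz, Functor.map_comp]; rfl
  · apply ((Δ.chartDiagram R).map fj).isOpenEmbedding.injective
    rw [← hx', ← hz, Subsingleton.elim (fli ≫ fi) (flj ≫ fj), Functor.map_comp]; rfl

/-- The toric scheme `X_Δ` over the ring `R`: the gluing of the affine toric schemes
`U_σ = Spec R[σ^∨ ∩ M]`, `σ ∈ Δ`, along the open immersions `U_τ → U_σ` for `τ ≤ σ`.
For a field `R` it is the split toric variety of the fan. -/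
def toricScheme (R : Type u) [CommRing R] : Scheme.{u} := colimit (Δ.chartDiagram R)

/-- The inclusion of the chart `U_σ` in `X_Δ`. -/
def chart (R : Type u) [CommRing R] (σ : Δ.ConeIndex) :
    Spec (CommRingCat.of (ConeRing R σ.1)) ⟶ Δ.toricScheme R :=
  colimit.ι (Δ.chartDiagram R) σ

instance chart_isOpenImmersion (R : Type u) [CommRing R] (σ : Δ.ConeIndex) :
    IsOpenImmersion (Δ.chart R σ) :=
  inferInstanceAs (IsOpenImmersion (colimit.ι (Δ.chartDiagram R) σ))

lemma coneRingMap_comp_algebraMap (R : Type u) [CommRing R] {τ σ : PointedCone ℝ (Fin n → ℝ)}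
    (h : τ ≤ σ) :
    (coneRingMap R h).comp (algebraMap R (ConeRing R σ)) = algebraMap R (ConeRing R τ) := by
  refine RingHom.ext fun r => ?_
  simp [coneRingMap]

/-- The structure morphism `X_Δ → Spec R`. -/
def structureMap (R : Type u) [CommRing R] : Δ.toricScheme R ⟶ Spec (CommRingCat.of R) :=
  colimit.desc (Δ.chartDiagram R)
    { pt := Spec (CommRingCat.of R)
      ι :=
        { app := fun σ => Spec.map (CommRingCat.ofHom (algebraMap R (ConeRing R σ.1)))
          naturality := by
            intro τ σ f
            change Spec.map (CommRingCat.ofHom (coneRingMap R f.le)) ≫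
              Spec.map (CommRingCat.ofHom (algebraMap R (ConeRing R σ.1))) = _ ≫ 𝟙 _
            rw [← Spec.map_comp, ← CommRingCat.ofHom_comp, coneRingMap_comp_algebraMap,
              Category.comp_id] } }

/-- The morphism `X_Δ(R') → X_Δ(R)` of toric schemes induced by a ring homomorphism `R → R'`
(given on charts by `R[σ^∨ ∩ M] → R'[σ^∨ ∩ M]`). -/
def baseChangeMap {R R' : Type u} [CommRing R] [CommRing R'] (φ : R →+* R') :
    Δ.toricScheme R' ⟶ Δ.toricScheme R :=
  colimMap
    { app := fun σ => Spec.map (CommRingCat.ofHom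
        (AddMonoidAlgebra.mapRingHom (dualMonoid σ.1) φ))
      naturality := by
        intro τ σ f
        change Spec.map (CommRingCat.ofHom (coneRingMap R' f.le)) ≫
            Spec.map (CommRingCat.ofHom (AddMonoidAlgebra.mapRingHom (dualMonoid σ.1) φ)) =
          Spec.map (CommRingCat.ofHom (AddMonoidAlgebra.mapRingHom (dualMonoid τ.1) φ)) ≫
            Spec.map (CommRingCat.ofHom (coneRingMap R f.le))
        rw [← Spec.map_comp, ← Spec.map_comp, ← CommRingCat.ofHom_comp, ← CommRingCat.ofHom_comp]
        congr 2
        refine RingHom.ext fun x => ?_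
        induction x using AddMonoidAlgebra.induction_linear with
        | zero => simp
        | add x y hx hy => rw [map_add, hx, hy, map_add]
        | single a r => simp [coneRingMap_single] }

/-- The affine open cover of `X_Δ` by the charts `U_σ`. -/
def chartCover (R : Type u) [CommRing R] : (Δ.toricScheme R).OpenCover :=
  Scheme.IsLocallyDirected.openCover (Δ.chartDiagram R)

lemma coneRing_isNoetherianRing (R : Type u) [CommRing R] [IsNoetherianRing R] (σ : Δ.ConeIndex) :
    IsNoetherianRing (ConeRing R σ.1) := by
  obtain ⟨s, hs⟩ := Δ.rational σ.1 σ.2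
  have : AddMonoid.FG (dualMonoid σ.1) :=
    (AddMonoid.fg_iff_addSubmonoid_fg _).2 (dualMonoid_fg hs)
  exact Algebra.FiniteType.isNoetherianRing R _

instance coneRing_isDomain (R : Type u) [CommRing R] [IsDomain R]
    (σ : PointedCone ℝ (Fin n → ℝ)) : IsDomain (ConeRing R σ) := by
  have : UniqueSums (dualMonoid σ) :=
    UniqueSums.of_injective_addHom (dualMonoid σ).subtype.toAddHom Subtype.val_injective inferInstance
  infer_instance

instance toricScheme_isLocallyNoetherian (R : Type u) [CommRing R] [IsNoetherianRing R] :
    IsLocallyNoetherian (Δ.toricScheme R) := by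
  refine (isLocallyNoetherian_iff_openCover (Δ.chartCover R)).2 fun σ => ?_
  have := Δ.coneRing_isNoetherianRing R σ
  exact inferInstanceAs (IsLocallyNoetherian (Spec (CommRingCat.of (ConeRing R σ.1))))

lemma exists_chart_eq (R : Type u) [CommRing R] (x : Δ.toricScheme R) :
    ∃ (σ : Δ.ConeIndex) (y : Spec (CommRingCat.of (ConeRing R σ.1))), Δ.chart R σ y = x :=
  (Δ.chartCover R).exists_eq x

instance toricScheme_isIntegral (R : Type u) [CommRing R] [IsDomain R] :
    IsIntegral (Δ.toricScheme R) := by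
  have hdom : ∀ σ : Δ.ConeIndex, IsIntegral (Spec (CommRingCat.of (ConeRing R σ.1))) :=
    fun σ => inferInstance
  have hred : IsReduced (Δ.toricScheme R) := by
    have : ∀ x : Δ.toricScheme R, _root_.IsReduced ((Δ.toricScheme R).presheaf.stalk x) := by
      intro x
      obtain ⟨σ, y, rfl⟩ := Δ.exists_chart_eq R x
      have := hdom σ
      have e := asIso ((Δ.chart R σ).stalkMap y)
      exact isReduced_of_injective e.hom.hom
        ((ConcreteCategory.bijective_of_isIso e.hom).1)
    exact isReduced_of_isReduced_stalk _
  have hne : Nonempty (Δ.toricScheme R) := by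
    obtain ⟨σ, hσ⟩ := Δ.nonempty_cones
    have := hdom ⟨σ, hσ⟩
    exact ⟨Δ.chart R ⟨σ, hσ⟩ (genericPoint (Spec (CommRingCat.of (ConeRing R σ))))⟩
  have hpre : PreirreducibleSpace (Δ.toricScheme R) := by
    refine PreirreducibleSpace.of_isOpenCover (U := fun σ => (Δ.chart R σ).opensRange) ?_ ?_ ?_
    · intro σ τ _ hdisj
      have hmem : σ.1 ⊓ τ.1 ∈ Δ.cones := Δ.face_mem σ.1 σ.2 _ (Δ.inter_face σ.1 σ.2 τ.1 τ.2)
      let l : Δ.ConeIndex := ⟨σ.1 ⊓ τ.1, hmem⟩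
      let f : l ⟶ σ := homOfLE (inf_le_left : σ.1 ⊓ τ.1 ≤ σ.1)
      let g : l ⟶ τ := homOfLE (inf_le_right : σ.1 ⊓ τ.1 ≤ τ.1)
      have := hdom l
      let z := genericPoint (Spec (CommRingCat.of (ConeRing R l.1)))
      have h1 : Δ.chart R l z ∈ (Δ.chart R σ).opensRange := by
        refine ⟨(Δ.chartDiagram R).map f z, ?_⟩
        have := colimit.w (Δ.chartDiagram R) f
        exact congr($this z)
      have h2 : Δ.chart R l z ∈ (Δ.chart R τ).opensRange := by
        refine ⟨(Δ.chartDiagram R).map g z, ?_⟩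
        have := colimit.w (Δ.chartDiagram R) g
        exact congr($this z)
      have h3 := hdisj.le_bot (show _ ∈ _ from ⟨h1, h2⟩)
      exact h3
    · rw [TopologicalSpace.IsOpenCover, eq_top_iff]
      intro x _
      obtain ⟨σ, y, rfl⟩ := Δ.exists_chart_eq R x
      exact TopologicalSpace.Opens.mem_iSup.2 ⟨σ, y, rfl⟩
    · intro σ
      have := hdom σ
      have h1 : IsPreirreducible (Set.range (Δ.chart R σ)) := by
        rw [← Set.image_univ]
        exact (PreirreducibleSpace.isPreirreducible_univ).image _
          (Δ.chart R σ).continuous.continuousOn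
      exact Subtype.preirreducibleSpace h1
  have hirr : IrreducibleSpace (Δ.toricScheme R) := { toNonempty := hne }
  exact isIntegral_of_irreducibleSpace_of_isReduced _

variable (K : Type u) [Field K]

/-- The closed orbit of the chart `U_σ`: the closed subset where all the characters `χ^m`,
`m ∈ σ^∨ ∩ M`, `m ∉ σ^⊥`, vanish. -/
def chartOrbit (σ : Δ.ConeIndex) : Set (Spec (CommRingCat.of (ConeRing K σ.1))) :=
  PrimeSpectrum.zeroLocus
    {f | ∃ m : dualMonoid σ.1, (∃ v ∈ σ.1, latticePairing (m : Fin n → ℤ) v ≠ 0) ∧ f = coneChar K m}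

/-- The toric subvariety `V(σ) ⊆ X_Δ` of codimension `dim σ`: the closure of the orbit of `σ`. For
`ρ ∈ Δ(1)` it is the toric divisor `D_ρ`. -/
def orbitClosure (σ : Δ.ConeIndex) : Set (Δ.toricScheme K) :=
  closure (Δ.chart K σ '' Δ.chartOrbit K σ)

/-- The intersection `⋂_{ρ ∈ σ(1)} D_ρ` of the toric divisors of the rays of `σ`. -/
def interRayDivisors (σ : PointedCone ℝ (Fin n → ℝ)) : Set (Δ.toricScheme K) :=
  ⋂ ρ : {ρ : Δ.ConeIndex // ρ.1 ∈ Δ.raysOf σ}, Δ.orbitClosure K ρ.1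

/-- The point `x` of the toric variety `X_Δ` over `K` is rational over `ℤ`: it is the image of the
`K`-point of `X_Δ` deduced, via `ℤ → K`, from a `ℤ`-point of the toric scheme `X_Δ` over `ℤ`. -/
def IsIntegerRational (x : Δ.toricScheme K) : Prop :=
  ∃ (s : Spec (CommRingCat.of (ULift.{u} ℤ)) ⟶ Δ.toricScheme (ULift.{u} ℤ))
    (t : Spec (CommRingCat.of K) ⟶ Δ.toricScheme K),
    s ≫ Δ.structureMap (ULift.{u} ℤ) = 𝟙 _ ∧
    t ≫ Δ.structureMap K = 𝟙 _ ∧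
    t ≫ Δ.baseChangeMap ((Int.castRingHom K).comp (ULift.ringEquiv : ULift.{u} ℤ ≃+* ℤ).toRingHom) =
      Spec.map (CommRingCat.ofHom
        ((Int.castRingHom K).comp (ULift.ringEquiv : ULift.{u} ℤ ≃+* ℤ).toRingHom)) ≫ s ∧
    Set.range t = {x}

end ToricFan

/-! ## Divisors -/

section Divisors

variable (X : Scheme.{u})

/-- The group of Weil divisors of `X`: the locally finite integral combinations of points of
codimension one (i.e. of generic points of prime divisors). -/
def weilDivisors : AddSubgroup (AlgebraicCycle X ℤ) where
  carrier := {D | ∀ x, D x ≠ 0 → Order.coheight x = 1}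
  zero_mem' := by intro x hx; exact absurd rfl hx
  add_mem' := by
    intro a b ha hb x hx
    by_cases h : a x = 0
    · refine hb x fun h' => hx ?_
      rw [Function.locallyFinsuppWithin.coe_add, Pi.add_apply, h, h', add_zero]
    · exact ha x h
  neg_mem' := by
    intro a ha x hx
    refine ha x fun h => hx ?_
    rw [Function.locallyFinsuppWithin.coe_neg, Pi.neg_apply, h, neg_zero]

/-- A Weil divisor of `X`. -/
abbrev WeilDivisor : Type u := weilDivisors X

variable {X}

namespace WeilDivisor

/-- The multiplicity of the prime divisor with generic point `x` in `D`. -/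
def coeff (D : WeilDivisor X) (x : X) : ℤ := D.1 x

/-- `D` is effective: all its multiplicities are nonnegative. -/
def IsEffective (D : WeilDivisor X) : Prop := ∀ x, 0 ≤ D.coeff x

/-- The support of `D`: the union of the prime divisors occurring in `D`. -/
def support (D : WeilDivisor X) : Set X := ⋃ x ∈ {x | D.coeff x ≠ 0}, closure {x}

variable [IsIntegral X] [IsLocallyNoetherian X]

/-- The rational function `g` is an equation of the `m`-th multiple of `D` on a neighbourhood of
the point `p`. -/
def IsLocalEquation (m : ℤ) (D : WeilDivisor X) (p : X) (g : X.functionField) : Prop :=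
  g ≠ 0 ∧ ∃ U : X.Opens, p ∈ U ∧ ∀ x ∈ U, m * D.coeff x = X.ord g x

/-- `D` is a Cartier divisor: it is locally principal. -/
def IsCartier (D : WeilDivisor X) : Prop := ∀ p : X, ∃ g, IsLocalEquation 1 D p g

/-- `D` is the divisor of a nonzero rational function. -/
def IsPrincipal (D : WeilDivisor X) : Prop :=
  ∃ g : X.functionField, g ≠ 0 ∧ ∀ x, D.coeff x = X.ord g x

variable (X) in
/-- The subgroup of principal divisors. -/
def principalSubgroup : AddSubgroup (WeilDivisor X) :=
  AddSubgroup.closure {D | D.IsPrincipal}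

variable (X) in
/-- The divisor class group `Cl(X)`. -/
abbrev ClassGroup : Type u := WeilDivisor X ⧸ principalSubgroup X

/-- `q` is the intersection number `D · C` of the `ℚ`-Cartier divisor `D` with the integral closed
curve `i : C → X`, `X` being a scheme over `S` (the spectrum of the ground field).

A positive multiple `m D` is Cartier, and `h` is a rational function such that `m D - div h` has
near every `i p`, `p ∈ C`, an equation `a p / b p` with `a p, b p ∈ 𝒪_{X, i p}` not vanishing
identically on `C`. So the functions `a p / b p` restricted to `C` define a Cartier divisor on `C`,
in the class of the restriction of `𝒪_X(m D)`, and `m q` is its degree: the sum over the closed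
points `p` of `C` of the orders of vanishing at `p` (computed as lengths), weighted by the degrees
of the residue fields over the ground field. (The terms vanish for all but finitely many `p`.) -/
def IsIntersectionNumber {S : Scheme.{u}} (π : X ⟶ S) (D : WeilDivisor X) {C : Scheme.{u}}
    (i : C ⟶ X) (q : ℚ) : Prop :=
  ∃ (m : ℕ) (h : X.functionField) (a b : ∀ p : C, X.presheaf.stalk (i p)),
    0 < m ∧ h ≠ 0 ∧
    (∀ p, i.stalkMap p (a p) ≠ 0 ∧ i.stalkMap p (b p) ≠ 0 ∧
      IsLocalEquation m D (i p) (h * (algebraMap _ X.functionField (a p) /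
        algebraMap _ X.functionField (b p)))) ∧
    m * q = ((∑ᶠ p : {p : C // IsClosed {p}},
      (((Ring.ord (C.presheaf.stalk p.1) (i.stalkMap p.1 (a p.1))).toNat : ℤ) -
        ((Ring.ord (C.presheaf.stalk p.1) (i.stalkMap p.1 (b p.1))).toNat : ℤ)) *
        ((i ≫ π).residueDegree p.1 : ℤ) : ℤ) : ℚ)

/-- `D` is nef, on the scheme `X` over `S` (the spectrum of the ground field): its intersection
number with every complete integral closed curve `C` of `X` is nonnegative. -/
def IsNef {S : Scheme.{u}} (π : X ⟶ S) (D : WeilDivisor X) : Prop :=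
  ∀ (C : Scheme.{u}) (i : C ⟶ X), IsClosedImmersion i → IsIntegral C →
    topologicalKrullDim C = 1 → IsProper (i ≫ π) →
    ∃ q : ℚ, IsIntersectionNumber π D i q ∧ 0 ≤ q

end WeilDivisor

end Divisors

/-- The order of the torsion part of the class group of `X` is prime to the characteristic of the
field `K` (no condition in characteristic zero). -/
def TorsionPrimeToChar (K : Type u) [Field K] (X : Scheme.{u}) [IsIntegral X]
    [IsLocallyNoetherian X] : Prop :=
  (Nat.card (AddCommGroup.torsion (WeilDivisor.ClassGroup X))).Coprime (ringExpChar K)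

end

/-!
The theorem is proved by contraposition: an effective divisor `D` whose support contains none of
the torus-fixed points `γ_σ` is both Cartier and nef.

The torus of `X_Δ` is the spectrum of the Laurent polynomial ring `K[M]`, which is factorial, so
`D` has an equation `f ∈ K[M]` on it (`ToricFan.exists_torus_divisor_equation`). Let `σ` be a cone
of full dimension. Each prime factor `π` of `f` is the equation of a prime divisor that does not
contain `γ_σ`, so it divides some function `x` on `U_σ` with `x(γ_σ) ≠ 0`, i.e. some `x ∈ K[σ^∨ ∩ M]`
with nonzero constant term. As Newton polytopes add up under multiplication and that of `x`
lies in `σ^∨` with `0` as an exponent, one of the exponents `m` of `π` minimizes all the elements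
of `σ`; then `π χ^{-m}` is a function on `U_σ` that does not vanish at `γ_σ`
(`exists_mul_torusChar_eq`). Hence there are exponents `m_σ` of `f` such that `f χ^{-m_σ}` is
regular on `U_σ` and nonzero at `γ_σ`. It is an equation of `D` on all of `U_σ`: the points of
codimension one of `U_σ` outside of the torus specialize to `γ_σ`, since their ideals contain a
character and hence are spanned by characters (`coeff_zero_eq_zero_of_height_eq_one`), so that
neither `D` nor `f χ^{-m_σ}` has a contribution there (`ToricFan.coeff_eq_ord_of_mem_chartOpen`).
The full-dimensional cones of a complete fan suffice to cover `X_Δ`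
(`ToricFan.exists_le_conesOfDim`), so `D` is Cartier.

Since `m_σ` is an exponent of `f`, the quotient `χ^{m_σ - m_τ}` of the equations of `D` on `U_τ`
and `U_σ` is regular on `U_τ`. Given a curve, take `σ` such that `U_σ` contains its generic point:
relative to the equation on `U_σ`, the local equations of `D` along the curve are regular
functions that do not vanish identically on the curve, so the degree is a sum of nonnegative terms
(`ToricFan.isNef_of_fixedPoint_notMem`).

Finally `γ_σ` is the point where all the nontrivial characters of `σ^∨` vanish; it is the only
point of `⋂ D_ρ` because the closure of the orbit of `ρ` meets only the charts of the cones
containing `ρ` (`ToricFan.interRayDivisors_eq`), and the homomorphism `K[σ^∨ ∩ M] → K` that it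
defines, the constant term, has an analogue over `ℤ`.
-/

noncomputable section

/-! ### Monoid algebras -/

section MonoidAlgebras

variable {R S : Type*} [CommRing R] [AddCommMonoid S]

open Classical in
/-- The projection `R[S] → R[S]` that kills the monomials whose exponent is not in the face `F`
of the monoid `S`. It is multiplicative because `F` is a face: a sum lies in `F` only if both
summands do. -/
def faceProj (F : AddSubmonoid S) (hF : ∀ a b, a + b ∈ F → a ∈ F ∧ b ∈ F) :
    AddMonoidAlgebra R S →ₐ[R] AddMonoidAlgebra R S :=
  AddMonoidAlgebra.lift R _ S
    { toFun := fun m => if m.toAdd ∈ F then AddMonoidAlgebra.single m.toAdd 1 else 0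
      map_one' := by
        rw [toAdd_one, if_pos F.zero_mem, AddMonoidAlgebra.one_def]
      map_mul' := by
        intro a b
        rw [toAdd_mul]
        by_cases h : a.toAdd + b.toAdd ∈ F
        · rw [if_pos h, if_pos (hF _ _ h).1, if_pos (hF _ _ h).2,
            AddMonoidAlgebra.single_mul_single, mul_one]
        · rw [if_neg h]
          by_cases ha : a.toAdd ∈ F
          · rw [if_neg (fun hb => h (F.add_mem ha hb)), mul_zero]
          · rw [if_neg ha, zero_mul] }

open Classical in
lemma coeff_faceProj (F : AddSubmonoid S) (hF : ∀ a b, a + b ∈ F → a ∈ F ∧ b ∈ F)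
    (x : AddMonoidAlgebra R S) (m : S) :
    (faceProj F hF x).coeff m = if m ∈ F then x.coeff m else 0 := by
  induction x using AddMonoidAlgebra.induction_linear with
  | zero => simp
  | add x y hx hy =>
    rw [map_add, AddMonoidAlgebra.coeff_add, AddMonoidAlgebra.coeff_add, Finsupp.add_apply,
      Finsupp.add_apply, hx, hy]
    split_ifs <;> simp
  | single a r =>
    simp only [faceProj, AddMonoidAlgebra.lift_single, MonoidHom.coe_mk, OneHom.coe_mk, toAdd_ofAdd]
    by_cases ha : a ∈ F
    · rw [if_pos ha, AddMonoidAlgebra.smul_single]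
      by_cases hm : m ∈ F
      · simp [hm]
      · rw [if_neg hm, AddMonoidAlgebra.coeff_single,
          Finsupp.single_eq_of_ne (by rintro rfl; exact hm ha)]
    · rw [if_neg ha, smul_zero, AddMonoidAlgebra.coeff_zero, Finsupp.zero_apply]
      by_cases hm : m ∈ F
      · rw [if_pos hm, AddMonoidAlgebra.coeff_single,
          Finsupp.single_eq_of_ne (by rintro rfl; exact ha hm)]
      · rw [if_neg hm]

/-- The ideal of `R[S]` spanned by the monomials whose exponent is not in the face `F` of `S`. -/
def faceIdeal (F : AddSubmonoid S) (hF : ∀ a b, a + b ∈ F → a ∈ F ∧ b ∈ F) :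
    Ideal (AddMonoidAlgebra R S) := RingHom.ker (faceProj (R := R) F hF)

lemma mem_faceIdeal {F : AddSubmonoid S} {hF : ∀ a b, a + b ∈ F → a ∈ F ∧ b ∈ F}
    {x : AddMonoidAlgebra R S} : x ∈ faceIdeal F hF ↔ ∀ m ∈ F, x.coeff m = 0 := by
  rw [faceIdeal, RingHom.mem_ker]
  constructor
  · intro h m hm
    have := coeff_faceProj F hF x m
    rw [if_pos hm] at this
    rw [← this, h]; simp
  · intro h
    ext m
    rw [coeff_faceProj]
    by_cases hm : m ∈ F
    · rw [if_pos hm, h m hm]; simp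
    · rw [if_neg hm]; simp

instance faceIdeal_isPrime [IsDomain (AddMonoidAlgebra R S)] (F : AddSubmonoid S)
    (hF : ∀ a b, a + b ∈ F → a ∈ F ∧ b ∈ F) : (faceIdeal (R := R) F hF).IsPrime :=
  RingHom.ker_isPrime _

lemma mem_of_forall_single_mem {I : Ideal (AddMonoidAlgebra R S)} {x : AddMonoidAlgebra R S}
    (h : ∀ m, x.coeff m ≠ 0 → AddMonoidAlgebra.single m 1 ∈ I) : x ∈ I := by
  rw [← AddMonoidAlgebra.sum_coeff_single x]
  refine I.sum_mem fun m hm => ?_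
  have := I.smul_of_tower_mem (x.coeff m) (h m (Finsupp.mem_support_iff.1 hm))
  simpa using this

/-- A face of the Newton polytope of a product is the sum of the corresponding faces of the Newton
polytopes of the factors: if the exponents of `f * g` are nonnegative on the linear form `ℓ`, and
`a`, `b` are exponents of `f`, `g` with `ℓ (a + b) = 0`, then `ℓ` is minimal at `a` among the
exponents of `f`. -/
lemma le_of_coeff_mul {A : Type*} [AddCommMonoid A] [UniqueSums A] [NoZeroDivisors R]
    {f g : AddMonoidAlgebra R A} (ℓ : A →+ ℝ) (hfg : ∀ c, (f * g).coeff c ≠ 0 → 0 ≤ ℓ c)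
    {a b : A} (ha : f.coeff a ≠ 0) (hb : g.coeff b ≠ 0) (hab : ℓ (a + b) = 0)
    {p : A} (hp : f.coeff p ≠ 0) : ℓ a ≤ ℓ p := by
  classical
  obtain ⟨a₁, ha₁, hmin₁⟩ := f.coeff.support.exists_min_image ℓ
    ⟨a, Finsupp.mem_support_iff.2 ha⟩
  obtain ⟨b₁, hb₁, hmin₂⟩ := g.coeff.support.exists_min_image ℓ
    ⟨b, Finsupp.mem_support_iff.2 hb⟩
  -- The exponents on which `ℓ` is minimal.
  set P := f.coeff.support.filter (fun c => ℓ c = ℓ a₁)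
  set Q := g.coeff.support.filter (fun c => ℓ c = ℓ b₁)
  obtain ⟨a₀, ha₀, b₀, hb₀, huniq⟩ := UniqueSums.uniqueAdd_of_nonempty (A := P) (B := Q)
    ⟨a₁, Finset.mem_filter.2 ⟨ha₁, rfl⟩⟩ ⟨b₁, Finset.mem_filter.2 ⟨hb₁, rfl⟩⟩
  obtain ⟨ha₀', hℓa⟩ := Finset.mem_filter.1 ha₀
  obtain ⟨hb₀', hℓb⟩ := Finset.mem_filter.1 hb₀
  have huniq' : UniqueAdd f.coeff.support g.coeff.support a₀ b₀ := by
    intro x y hx hy hxy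
    have h1 := hmin₁ x hx
    have h2 := hmin₂ y hy
    have h3 : ℓ x + ℓ y = ℓ a₀ + ℓ b₀ := by rw [← map_add, hxy, map_add]
    refine huniq (Finset.mem_filter.2 ⟨hx, ?_⟩) (Finset.mem_filter.2 ⟨hy, ?_⟩) hxy <;> linarith
  have hne : (f * g).coeff (a₀ + b₀) ≠ 0 := by
    rw [AddMonoidAlgebra.coeff_mul_add_of_uniqueAdd huniq']
    exact mul_ne_zero (Finsupp.mem_support_iff.1 ha₀') (Finsupp.mem_support_iff.1 hb₀')
  have h0 := hfg _ hne
  have h1 := hmin₂ b (Finsupp.mem_support_iff.2 hb)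
  have h2 := hmin₁ p (Finsupp.mem_support_iff.2 hp)
  rw [map_add] at h0 hab
  linarith

end MonoidAlgebras

/-! ### The coordinate rings of cones inside the Laurent polynomial ring -/

section ConeRings

variable {n : ℕ}

lemma latticePairing_neg_left (a : Fin n → ℤ) (v : Fin n → ℝ) :
    latticePairing (-a) v = -latticePairing a v := by
  simp [latticePairing]

lemma mem_dualMonoid_bot (m : Fin n → ℤ) :
    m ∈ dualMonoid (⊥ : PointedCone ℝ (Fin n → ℝ)) := by
  intro v hv
  rw [(Submodule.mem_bot _).1 hv, latticePairing_zero_right]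

instance dualMonoid_uniqueSums (σ : PointedCone ℝ (Fin n → ℝ)) : UniqueSums (dualMonoid σ) :=
  UniqueSums.of_injective_addHom (dualMonoid σ).subtype.toAddHom Subtype.val_injective inferInstance

variable (R : Type u) [CommRing R]

/-- The character `χ^m`, `m ∈ M`, in the Laurent polynomial ring `R[M]`, which is the ring of the
zero cone. -/
def torusChar (m : Fin n → ℤ) : ConeRing R (⊥ : PointedCone ℝ (Fin n → ℝ)) :=
  coneChar R ⟨m, mem_dualMonoid_bot m⟩

lemma torusChar_add (a b : Fin n → ℤ) :
    torusChar R (a + b) = torusChar R a * torusChar R b := by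
  simp only [torusChar, coneChar, AddMonoidAlgebra.single_mul_single, mul_one]
  rfl

lemma torusChar_zero : torusChar R (0 : Fin n → ℤ) = 1 := by
  rw [AddMonoidAlgebra.one_def]; rfl

lemma torusChar_mul_neg (m : Fin n → ℤ) : torusChar R m * torusChar R (-m) = 1 := by
  rw [← torusChar_add, add_neg_cancel, torusChar_zero]

lemma isUnit_torusChar (m : Fin n → ℤ) : IsUnit (torusChar R m) :=
  IsUnit.of_mul_eq_one _ (torusChar_mul_neg R m)

lemma coneRingMap_coneChar {τ σ : PointedCone ℝ (Fin n → ℝ)} (h : τ ≤ σ) (m : dualMonoid σ) :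
    coneRingMap R h (coneChar R m) =
      coneChar R (AddSubmonoid.inclusion (dualMonoid_anti h) m) :=
  coneRingMap_single R h m 1

lemma coeff_coneRingMap {τ σ : PointedCone ℝ (Fin n → ℝ)} (h : τ ≤ σ) (x : ConeRing R σ)
    (m : dualMonoid σ) :
    (coneRingMap R h x).coeff (AddSubmonoid.inclusion (dualMonoid_anti h) m) = x.coeff m :=
  Finsupp.mapDomain_apply (AddSubmonoid.inclusion_injective _) _ _

lemma mem_of_coeff_coneRingMap_ne_zero {τ σ : PointedCone ℝ (Fin n → ℝ)} (h : τ ≤ σ)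
    {x : ConeRing R σ} {m : dualMonoid τ} (hm : (coneRingMap R h x).coeff m ≠ 0) :
    (m : Fin n → ℤ) ∈ dualMonoid σ := by
  classical
  have hm' := Finsupp.mapDomain_support (Finsupp.mem_support_iff.2 hm)
  obtain ⟨a, -, rfl⟩ := Finset.mem_image.1 hm'
  exact a.2

lemma exists_coneRingMap_eq {τ σ : PointedCone ℝ (Fin n → ℝ)} (h : τ ≤ σ) {x : ConeRing R τ}
    (hx : ∀ m, x.coeff m ≠ 0 → (m : Fin n → ℤ) ∈ dualMonoid σ) :
    ∃ y : ConeRing R σ, coneRingMap R h y = x := by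
  change x ∈ (coneRingMap R h).range
  rw [← AddMonoidAlgebra.sum_coeff_single x]
  refine Subring.sum_mem _ fun m hm => ?_
  exact ⟨AddMonoidAlgebra.single ⟨m, hx m (Finsupp.mem_support_iff.1 hm)⟩ (x.coeff m),
    coneRingMap_single R h _ _⟩

lemma coeff_mul_torusChar (x : ConeRing R (⊥ : PointedCone ℝ (Fin n → ℝ))) (a m : Fin n → ℤ) :
    (x * torusChar R a).coeff ⟨m, mem_dualMonoid_bot m⟩ =
      x.coeff ⟨m - a, mem_dualMonoid_bot _⟩ := by
  rw [torusChar, coneChar, AddMonoidAlgebra.coeff_mul_single_eq_coeff_mul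
    (m₂ := ⟨m - a, mem_dualMonoid_bot _⟩), mul_one]
  intro m' _
  rw [Subtype.ext_iff, Subtype.ext_iff]
  exact eq_sub_iff_add_eq.symm

/-- If a Laurent polynomial `f` divides a function of the affine toric variety of `σ` with nonzero
constant term, then `f` is up to a character such a function itself. The character is the inverse
of the exponent `m` of `f` that contributes to the constant term: it minimizes over the exponents of
`f` every linear form that is nonnegative on the dual cone of `σ`. -/
lemma exists_mul_torusChar_eq [IsDomain R] {σ : PointedCone ℝ (Fin n → ℝ)}
    {f g : ConeRing R (⊥ : PointedCone ℝ (Fin n → ℝ))} {x : ConeRing R σ} (hx : x.coeff 0 ≠ 0)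
    (hfg : f * g = coneRingMap R bot_le x) :
    ∃ (m : Fin n → ℤ) (y : ConeRing R σ), y.coeff 0 ≠ 0 ∧
      coneRingMap R bot_le y = f * torusChar R (-m) := by
  classical
  have h0 : (f * g).coeff 0 ≠ 0 := by
    have h1 := coeff_coneRingMap R (bot_le : ⊥ ≤ σ) x 0
    rw [map_zero] at h1
    rwa [hfg, h1]
  obtain ⟨a, ha, b, hb, hab⟩ := Finset.mem_add.1
    (AddMonoidAlgebra.support_coeff_mul_subset f g (Finsupp.mem_support_iff.2 h0))
  rw [Finsupp.mem_support_iff] at ha hb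
  -- The pairing with a vector of `σ` is minimal at `a` on the exponents of `f`.
  have hmin : ∀ p, f.coeff p ≠ 0 → p.1 - a.1 ∈ dualMonoid σ := by
    intro p hp v hv
    let ℓ : dualMonoid (⊥ : PointedCone ℝ (Fin n → ℝ)) →+ ℝ :=
      { toFun := fun m => latticePairing (m : Fin n → ℤ) v
        map_zero' := by simp [latticePairing]
        map_add' := fun c d => latticePairing_add_left _ _ _ }
    have h1 : ℓ a ≤ ℓ p := by
      refine le_of_coeff_mul ℓ (fun c hc => ?_) ha hb (by rw [hab, map_zero]) hp
      rw [hfg] at hc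
      exact mem_of_coeff_coneRingMap_ne_zero R bot_le hc v hv
    have h2 : latticePairing (p.1 - a.1) v = ℓ p - ℓ a := by
      rw [sub_eq_add_neg, latticePairing_add_left, latticePairing_neg_left, ← sub_eq_add_neg]; rfl
    rw [h2]; linarith
  have hcoeff : ∀ m : Fin n → ℤ, (f * torusChar R (-a.1)).coeff ⟨m, mem_dualMonoid_bot m⟩ =
      f.coeff ⟨m + a.1, mem_dualMonoid_bot _⟩ := by
    intro m
    rw [coeff_mul_torusChar]
    simp only [sub_neg_eq_add]
  obtain ⟨y, hy⟩ := exists_coneRingMap_eq R (bot_le : ⊥ ≤ σ) (x := f * torusChar R (-a.1)) (by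
    rintro ⟨m, hm⟩ hne
    rw [hcoeff] at hne
    simpa using hmin _ hne)
  refine ⟨a.1, y, ?_, hy⟩
  have h1 := coeff_coneRingMap R (bot_le : ⊥ ≤ σ) y 0
  have h2 := hcoeff 0
  rw [← h1, map_zero, hy]
  refine fun h3 => ha ?_
  have h4 := h2.symm.trans h3
  simpa using h4

end ConeRings

/-! ### Cones of a complete fan -/

section Cones

lemma PointedCone.isClosed_hull_of_finite {E : Type*} [NormedAddCommGroup E] [NormedSpace ℝ E]
    {S : Set E} (hS : S.Finite)
    (hpos : ∀ v ∈ PointedCone.hull ℝ S, -v ∈ PointedCone.hull ℝ S → v = 0) :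
    IsClosed (PointedCone.hull ℝ S : Set E) := by
  set σ := PointedCone.hull ℝ S
  have hsmul : ∀ c : ℝ, 0 ≤ c → ∀ x ∈ σ, c • x ∈ σ := fun c hc x hx => σ.smul_mem hc hx
  -- The cone is spanned by the compact set `C`, which does not contain the origin.
  set C := convexHull ℝ (S \ {0})
  have hCcomp : IsCompact C := hS.sdiff.isCompact_convexHull ℝ
  have hC : C ⊆ {x | x ∈ σ ∧ x ≠ 0} := by
    refine convexHull_min (fun x hx => ⟨PointedCone.subset_hull hx.1, hx.2⟩) ?_
    rintro x ⟨hx, hx0⟩ y ⟨hy, hy0⟩ a b ha hb hab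
    refine ⟨σ.add_mem (hsmul a ha x hx) (hsmul b hb y hy), fun h0 => ?_⟩
    have h1 : a • x = 0 := by
      refine hpos _ (hsmul a ha x hx) ?_
      rw [neg_eq_of_add_eq_zero_right h0]
      exact hsmul b hb y hy
    have h2 : b • y = 0 := by rwa [h1, zero_add] at h0
    rw [smul_eq_zero, or_iff_left hx0] at h1
    rw [smul_eq_zero, or_iff_left hy0] at h2
    linarith
  have hrep : ∀ x ∈ σ, x = 0 ∨ ∃ c : ℝ, 0 < c ∧ ∃ y ∈ C, c • y = x := by
    intro x hx
    induction hx using Submodule.span_induction with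
    | mem x hx =>
      by_cases h0 : x = 0
      · exact .inl h0
      · exact .inr ⟨1, one_pos, x, subset_convexHull ℝ _ ⟨hx, h0⟩, one_smul _ _⟩
    | zero => exact .inl rfl
    | add x y _ _ hx hy =>
      rcases hx with rfl | hx
      · rwa [zero_add]
      rcases hy with rfl | hy
      · rw [add_zero]; exact .inr hx
      · have hconv : Convex ℝ C := convex_convexHull ℝ _
        have h1 : x ∈ ConvexCone.hull ℝ C := (ConvexCone.mem_hull_of_convex hconv).2 hx
        have h2 : y ∈ ConvexCone.hull ℝ C := (ConvexCone.mem_hull_of_convex hconv).2 hy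
        exact .inr ((ConvexCone.mem_hull_of_convex hconv).1 (ConvexCone.add_mem _ h1 h2))
    | smul c x _ hx =>
      rcases hx with rfl | ⟨d, hd, y, hy, rfl⟩
      · exact .inl (smul_zero c)
      · rcases c.2.eq_or_lt with h0 | h0
        · left
          have : c = 0 := Subtype.ext h0.symm
          rw [this, zero_smul]
        · exact .inr ⟨c * d, mul_pos h0 hd, y, hy, mul_smul _ _ _⟩
  rcases C.eq_empty_or_nonempty with hempty | ⟨y₀, hy₀⟩
  · have : (σ : Set E) = {0} := by
      refine Set.eq_singleton_iff_unique_mem.2 ⟨σ.zero_mem, fun x hx => ?_⟩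
      rcases hrep x hx with h | ⟨c, -, y, hy, -⟩
      · exact h
      · rw [hempty] at hy; exact hy.elim
    rw [this]; exact isClosed_singleton
  have hσ : (σ : Set E) = Prod.fst '' {p : E × C | ‖(p.2 : E)‖ • p.1 = ‖p.1‖ • (p.2 : E)} := by
    ext x
    constructor
    · intro hx
      rcases hrep x hx with rfl | ⟨c, hc, y, hy, rfl⟩
      · exact ⟨(0, ⟨y₀, hy₀⟩), by simp, rfl⟩
      · refine ⟨(c • y, ⟨y, hy⟩), ?_, rfl⟩
        simp only [Set.mem_ofPred_eq, norm_smul, smul_smul, Real.norm_of_nonneg hc.le]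
        rw [mul_comm]
    · rintro ⟨⟨x, y⟩, h, rfl⟩
      obtain ⟨hy, hy0⟩ := hC y.2
      have hn : ‖(y : E)‖ ≠ 0 := norm_ne_zero_iff.2 hy0
      have : x = (‖(y : E)‖⁻¹ * ‖x‖) • (y : E) := by
        rw [mul_smul, ← show _ = _ from h, smul_smul, inv_mul_cancel₀ hn, one_smul]
      change x ∈ σ
      rw [this]
      exact hsmul _ (by positivity) _ hy
  have : CompactSpace C := isCompact_iff_compactSpace.1 hCcomp
  rw [hσ]
  refine isClosedMap_fst_of_compactSpace _ (isClosed_eq ?_ ?_) <;> fun_prop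

lemma latticePairing_sum_right {n : ℕ} {ι : Type*} (a : Fin n → ℤ) (s : Finset ι)
    (v : ι → Fin n → ℝ) :
    latticePairing a (∑ i ∈ s, v i) = ∑ i ∈ s, latticePairing a (v i) := by
  classical
  induction s using Finset.induction_on with
  | empty => simp [latticePairing]
  | insert i s hi ih =>
    rw [Finset.sum_insert hi, Finset.sum_insert hi, latticePairing_add_right, ih]

/-- A character that is trivial on a cone is trivial on its linear span. -/
lemma latticePairing_eq_zero_of_mem_span {n : ℕ} {m : Fin n → ℤ} {S : Set (Fin n → ℝ)}
    (h : ∀ v ∈ S, latticePairing m v = 0) {v : Fin n → ℝ} (hv : v ∈ Submodule.span ℝ S) :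
    latticePairing m v = 0 := by
  induction hv using Submodule.span_induction with
  | mem v hv => exact h v hv
  | zero => exact latticePairing_zero_right m
  | add v w _ _ hv hw => rw [latticePairing_add_right, hv, hw, add_zero]
  | smul c v _ hv => rw [latticePairing_smul_right, hv, mul_zero]

lemma span_eq_top_of_coneDim_eq {n : ℕ} {σ : PointedCone ℝ (Fin n → ℝ)} (h : coneDim σ = n) :
    Submodule.span ℝ (σ : Set (Fin n → ℝ)) = ⊤ :=
  Submodule.eq_top_of_finrank_eq (by rw [← coneDim, h, Module.finrank_fin_fun])

/-- A character that is trivial on a full-dimensional cone is trivial. -/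
lemma eq_zero_of_latticePairing_eq_zero {n : ℕ} {σ : PointedCone ℝ (Fin n → ℝ)}
    (hσ : coneDim σ = n) {m : Fin n → ℤ} (h : ∀ v ∈ σ, latticePairing m v = 0) : m = 0 := by
  ext i
  have h1 : latticePairing m (Pi.single i 1) = 0 :=
    latticePairing_eq_zero_of_mem_span h (by
      rw [span_eq_top_of_coneDim_eq hσ]; exact Submodule.mem_top)
  simpa [latticePairing, Pi.single_apply] using h1

namespace ToricFan

variable {n : ℕ} (Δ : ToricFan n)

lemma isClosed_of_mem_cones {σ : PointedCone ℝ (Fin n → ℝ)} (hσ : σ ∈ Δ.cones) :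
    IsClosed (σ : Set (Fin n → ℝ)) := by
  obtain ⟨s, hs⟩ := Δ.rational σ hσ
  have := Δ.strongly_convex σ hσ
  rw [hs] at this ⊢
  exact PointedCone.isClosed_hull_of_finite (s.finite_toSet.image _) this

/-- The zero cone belongs to a complete fan: it is the intersection of all the cones. -/
lemma bot_mem_cones (hcompl : Δ.IsComplete) : ⊥ ∈ Δ.cones := by
  have hne : Δ.finite_cones.toFinset.Nonempty := by
    simpa using Δ.nonempty_cones
  have hmem : Δ.finite_cones.toFinset.inf' hne id ∈ Δ.cones := by
    refine Finset.inf'_induction hne id (p := fun τ => τ ∈ Δ.cones) ?_ ?_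
    · exact fun σ hσ τ hτ => Δ.face_mem σ hσ _ (Δ.inter_face σ hσ τ hτ)
    · exact fun σ hσ => by simpa using hσ
  have hbot : Δ.finite_cones.toFinset.inf' hne id = ⊥ := by
    refine (Submodule.eq_bot_iff _).2 fun v hv => ?_
    obtain ⟨σ, hσ, hvσ⟩ := hcompl (-v)
    have hle : Δ.finite_cones.toFinset.inf' hne id ≤ σ :=
      Finset.inf'_le id (by simpa using hσ)
    exact Δ.strongly_convex σ hσ v (hle hv) hvσ
  rwa [hbot] at hmem

/-- If a cone `σ` of the fan contains the sum of the generators of the cone `τ`, which is a point in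
the relative interior of `τ`, then `τ` is a face of `σ`. -/
lemma le_of_sum_mem {τ σ : PointedCone ℝ (Fin n → ℝ)} (hτ : τ ∈ Δ.cones) (hσ : σ ∈ Δ.cones)
    {s : Finset (Fin n → ℤ)}
    (hs : τ = PointedCone.hull ℝ
      ((fun (w : Fin n → ℤ) (i : Fin n) => (w i : ℝ)) '' (s : Set (Fin n → ℤ))))
    (h : ∑ w ∈ s, (fun i => (w i : ℝ)) ∈ σ) : τ ≤ σ := by
  have hgen : ∀ w ∈ s, (fun i => (w i : ℝ)) ∈ τ := fun w hw => by
    rw [hs]; exact PointedCone.subset_hull (Set.mem_image_of_mem _ hw)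
  obtain ⟨m, hm, hface⟩ := Δ.inter_face τ hτ σ hσ
  have h0 := ((hface _).1 ⟨Submodule.sum_mem _ fun w hw => hgen w hw, h⟩).2
  rw [latticePairing_sum_right, Finset.sum_eq_zero_iff_of_nonneg fun w hw => hm _ (hgen w hw)] at h0
  rw [hs]
  refine Submodule.span_le.2 ?_
  rintro _ ⟨w, hw, rfl⟩
  exact ((hface _).2 ⟨hgen w hw, h0 w hw⟩).2

/-- Every cone of a complete fan is contained in a full-dimensional one: near a point `v` of its
relative interior, a generic half-line from `v` leaves all the cones of smaller dimension, and
so infinitely many points of it tending to `v` lie in a single full-dimensional cone. -/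
lemma exists_le_conesOfDim (hcompl : Δ.IsComplete) {τ : PointedCone ℝ (Fin n → ℝ)}
    (hτ : τ ∈ Δ.cones) : ∃ σ ∈ Δ.conesOfDim n, τ ≤ σ := by
  classical
  obtain ⟨s, hs⟩ := Δ.rational τ hτ
  set v : Fin n → ℝ := ∑ w ∈ s, (fun i => (w i : ℝ))
  let T : Finset (Submodule ℝ (Fin n → ℝ)) :=
    (Δ.finite_cones.toFinset.image fun σ : PointedCone ℝ (Fin n → ℝ) =>
      Submodule.span ℝ (σ : Set (Fin n → ℝ))).erase ⊤
  obtain ⟨w, hw⟩ := (Set.ne_univ_iff_exists_notMem _).1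
    (Subspace.biUnion_ne_univ_of_top_notMem (s := T) (by simp [T]))
  have hch : ∀ k : ℕ, ∃ σ : Δ.ConeIndex, v + (1 / ((k : ℝ) + 1)) • w ∈ σ.1 := by
    intro k
    obtain ⟨σ, hσ, h⟩ := hcompl (v + (1 / ((k : ℝ) + 1)) • w)
    exact ⟨⟨σ, hσ⟩, h⟩
  choose c hc using hch
  have : Finite Δ.ConeIndex := Δ.finite_cones
  obtain ⟨σ, hσ⟩ := Finite.exists_infinite_fiber c
  rw [Set.infinite_coe_iff] at hσ
  refine ⟨σ.1, ⟨σ.2, ?_⟩, Δ.le_of_sum_mem hτ σ.2 hs ?_⟩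
  · obtain ⟨k, hk, l, hl, hkl⟩ := hσ.nontrivial
    have hk' : v + (1 / ((k : ℝ) + 1)) • w ∈ Submodule.span ℝ (σ.1 : Set (Fin n → ℝ)) :=
      Submodule.subset_span (hk ▸ hc k)
    have hl' : v + (1 / ((l : ℝ) + 1)) • w ∈ Submodule.span ℝ (σ.1 : Set (Fin n → ℝ)) :=
      Submodule.subset_span (hl ▸ hc l)
    have hsub := Submodule.sub_mem _ hk' hl'
    rw [add_sub_add_left_eq_sub, ← sub_smul] at hsub
    have hne : (1 / ((k : ℝ) + 1)) - 1 / ((l : ℝ) + 1) ≠ 0 := by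
      rw [sub_ne_zero]
      intro h
      refine hkl ?_
      have hk0 : (k : ℝ) + 1 ≠ 0 := by positivity
      have hl0 : (l : ℝ) + 1 ≠ 0 := by positivity
      field_simp at h
      have : (l : ℝ) = k := by linarith
      exact_mod_cast this.symm
    have hwσ := (Submodule.smul_mem_iff _ hne).1 hsub
    have htop : Submodule.span ℝ (σ.1 : Set (Fin n → ℝ)) = ⊤ := by
      by_contra hne'
      refine hw (Set.mem_biUnion (x := Submodule.span ℝ (σ.1 : Set (Fin n → ℝ))) ?_ hwσ)
      refine Finset.mem_coe.2 (Finset.mem_erase.2 ⟨hne', Finset.mem_image.2 ⟨σ.1, ?_, rfl⟩⟩)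
      exact Δ.finite_cones.mem_toFinset.2 σ.2
    rw [coneDim, htop, finrank_top, Module.finrank_fin_fun]
  · have hlim : Filter.Tendsto (fun k : ℕ => v + (1 / ((k : ℝ) + 1)) • w)
        Filter.atTop (nhds v) := by
      have := (tendsto_one_div_add_atTop_nhds_zero_nat (𝕜 := ℝ)).smul_const w
      simpa using this.const_add v
    refine (Δ.isClosed_of_mem_cones σ.2).mem_of_frequently_of_tendsto ?_ hlim
    refine (Nat.frequently_atTop_iff_infinite.2 hσ).mono fun k hk => ?_
    exact hk ▸ hc k

/-- A full-dimensional cone is maximal in the fan. -/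
lemma eq_of_le_of_coneDim_eq {σ τ : PointedCone ℝ (Fin n → ℝ)} (hσ : σ ∈ Δ.conesOfDim n)
    (hτ : τ ∈ Δ.cones) (h : σ ≤ τ) : σ = τ := by
  obtain ⟨m, -, hface⟩ := Δ.isConeFace_of_le hσ.1 hτ h
  have h0 : m = 0 := eq_zero_of_latticePairing_eq_zero hσ.2 fun v hv => ((hface v).1 hv).2
  refine le_antisymm h fun v hv => (hface v).2 ⟨hv, ?_⟩
  rw [h0]; simp [latticePairing]

end ToricFan

end Cones

/-! ### The Laurent polynomial ring is factorial -/

section Factorial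

variable (n : ℕ)

/-- The positive orthant in `ℝⁿ`, whose ring is the polynomial ring in `n` variables. -/
def orthant : PointedCone ℝ (Fin n → ℝ) :=
  PointedCone.hull ℝ ((fun (w : Fin n → ℤ) (i : Fin n) => (w i : ℝ)) ''
    ((Finset.univ.image fun i : Fin n => (Pi.single i 1 : Fin n → ℤ) : Finset (Fin n → ℤ)) :
      Set (Fin n → ℤ)))

variable {n}

lemma mem_dualMonoid_orthant {m : Fin n → ℤ} : m ∈ dualMonoid (orthant n) ↔ ∀ i, 0 ≤ m i := by
  rw [orthant, mem_dualMonoid_hull]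
  simp [Pi.single_apply]

lemma nonneg_of_mem_orthant {v : Fin n → ℝ} (hv : v ∈ orthant n) (i : Fin n) : 0 ≤ v i := by
  have h : (Pi.single i 1 : Fin n → ℤ) ∈ dualMonoid (orthant n) :=
    mem_dualMonoid_orthant.2 fun j => by
      by_cases hj : j = i
      · subst hj; simp
      · simp [hj]
  have := h v hv
  simpa [latticePairing, Pi.single_apply] using this

variable (n) in
/-- The lattice points of the dual of the positive orthant are the exponents of the monomials. -/
def dualMonoidOrthantEquiv : dualMonoid (orthant n) ≃+ (Fin n →₀ ℕ) where
  toFun m := Finsupp.equivFunOnFinite.symm fun i => (m.1 i).toNat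
  invFun a := ⟨fun i => a i, mem_dualMonoid_orthant.2 fun _ => Int.natCast_nonneg _⟩
  left_inv m := by
    ext i
    simp [mem_dualMonoid_orthant.1 m.2 i]
  right_inv a := by
    ext i
    simp
  map_add' a b := by
    ext i
    simp [Int.toNat_add (mem_dualMonoid_orthant.1 a.2 i) (mem_dualMonoid_orthant.1 b.2 i)]

variable (K : Type u) [Field K]

instance coneRing_bot_uniqueFactorizationMonoid :
    UniqueFactorizationMonoid (ConeRing K (⊥ : PointedCone ℝ (Fin n → ℝ))) := by
  have hle : (⊥ : PointedCone ℝ (Fin n → ℝ)) ≤ orthant n := bot_le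
  have hm : (fun _ => 1 : Fin n → ℤ) ∈ dualMonoid (orthant n) :=
    mem_dualMonoid_orthant.2 fun _ => zero_le_one
  have hloc := coneRingMap_isLocalization K hle (s := Finset.univ.image fun i => Pi.single i 1) rfl
    hm (fun v => by
      rw [Submodule.mem_bot]
      constructor
      · rintro rfl
        exact ⟨Submodule.zero_mem _, latticePairing_zero_right _⟩
      · rintro ⟨hv, h0⟩
        have h1 : ∑ i, v i = 0 := by simpa [latticePairing] using h0
        rw [Finset.sum_eq_zero_iff_of_nonneg fun i _ => nonneg_of_mem_orthant hv i] at h1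
        exact funext fun i => h1 i (Finset.mem_univ i))
  have hufd : UniqueFactorizationMonoid (MvPolynomial (Fin n) K) := inferInstance
  let e : ConeRing K (orthant n) ≃* MvPolynomial (Fin n) K :=
    (AddMonoidAlgebra.domCongr K K (dualMonoidOrthantEquiv n)).toMulEquiv
  have := e.symm.uniqueFactorizationMonoid hufd
  let _ := (coneRingMap K hle).toAlgebra
  exact UniqueFactorizationMonoid.of_isLocalization
    (Submonoid.powers (coneChar K (⟨_, hm⟩ : dualMonoid (orthant n)))) _

end Factorial

/-! ### Orders of vanishing -/

section Orders

variable {X : Scheme.{u}} [IsIntegral X] [IsLocallyNoetherian X]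

lemma AlgebraicGeometry.Scheme.ord_algebraMap_of_isUnit {x : X} {s : X.presheaf.stalk x}
    (hs : IsUnit s) :
    X.ord (algebraMap _ X.functionField s) x = 0 := by
  by_cases hx : Order.coheight x = 1
  · have : Ring.KrullDimLE 1 (X.presheaf.stalk x) := krullDimLE_of_coheight_le hx.le
    have hne : algebraMap (X.presheaf.stalk x) X.functionField s ≠ 0 := (hs.map _).ne_zero
    rw [Scheme.ord_eq_iff hx hne]
    exact Ring.ordFrac_of_isUnit hs
  · exact Scheme.ord_eq_zero_of_coheight_neq_one hx _

/-- The generator of the maximal ideal of the local ring of a prime divisor vanishes to order one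
on it. -/
lemma AlgebraicGeometry.Scheme.ord_algebraMap_of_span_eq_maximalIdeal {x : X}
    (hx : Order.coheight x = 1)
    {s : X.presheaf.stalk x} (h0 : s ≠ 0)
    (hs : Ideal.span {s} = IsLocalRing.maximalIdeal (X.presheaf.stalk x)) :
    X.ord (algebraMap _ X.functionField s) x = 1 := by
  have : Ring.KrullDimLE 1 (X.presheaf.stalk x) := krullDimLE_of_coheight_le hx.le
  have hne : algebraMap (X.presheaf.stalk x) X.functionField s ≠ 0 := by
    rwa [Ne, map_eq_zero_iff _ (IsFractionRing.injective _ _)]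
  rw [Scheme.ord_eq_iff hx hne]
  have hord : Ring.ord (X.presheaf.stalk x) s = (1 : ℕ) := by
    rw [Ring.ord, hs, Nat.cast_one, Module.length_eq_one_iff,
      isSimpleModule_iff_isCoatom]
    exact Ideal.isMaximal_def.1 inferInstance
  change Ring.ordFrac (X.presheaf.stalk x) _ = _
  rw [Ring.ordFrac_eq_ord _ h0, Ring.ordMonoidWithZeroHom_eq_coe _
    (mem_nonZeroDivisors_of_ne_zero h0) hord]
  rfl

lemma AlgebraicGeometry.Scheme.ord_prod {ι : Type*} (s : Finset ι) (g : ι → X.functionField)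
    (hg : ∀ i ∈ s, g i ≠ 0)
    (x : X) : X.ord (∏ i ∈ s, g i) x = ∑ i ∈ s, X.ord (g i) x := by
  classical
  induction s using Finset.induction_on with
  | empty =>
    have := Scheme.ord_algebraMap_of_isUnit (x := x) isUnit_one
    simpa using this
  | insert i s hi ih =>
    have h1 := fun j hj => hg j (Finset.mem_insert_of_mem hj)
    rw [Finset.prod_insert hi, Finset.sum_insert hi, ← ih h1]
    exact Scheme.ord_mul (hg i (Finset.mem_insert_self i s)) (Finset.prod_ne_zero_iff.2 h1)

lemma AlgebraicGeometry.Scheme.ord_pow {g : X.functionField} (hg : g ≠ 0) (k : ℕ) (x : X) :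
    X.ord (g ^ k) x = k * X.ord g x := by
  have := Scheme.ord_prod (Finset.range k) (fun _ => g) (fun _ _ => hg) x
  simpa using this

end Orders

/-! ### Functions on an affine open chart -/

section AffineCharts

variable {X : Scheme.{u}} {A B : CommRingCat.{u}}

/-- The elements of `A`, seen as functions on the image of the open immersion `f : Spec A ⟶ X`. -/
def specSection (f : Spec A ⟶ X) [IsOpenImmersion f] : A ⟶ Γ(X, f ''ᵁ ⊤) :=
  (Scheme.ΓSpecIso A).inv ≫ (f.appIso ⊤).inv

lemma specSection_map (f : Spec A ⟶ X) (g : Spec B ⟶ X) [IsOpenImmersion f] [IsOpenImmersion g]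
    (φ : A ⟶ B) (h : Spec.map φ ≫ f = g) (hle : g ''ᵁ ⊤ ≤ f ''ᵁ ⊤) :
    specSection f ≫ X.presheaf.map (homOfLE hle).op = φ ≫ specSection g := by
  have e' : ⊤ ≤ f ⁻¹ᵁ f ''ᵁ ⊤ := (f.preimage_image_eq ⊤).ge
  have e : ⊤ ≤ g ⁻¹ᵁ f ''ᵁ ⊤ := (g.preimage_image_eq ⊤).ge.trans (g.preimage_mono hle)
  have e'' : ⊤ ≤ Spec.map φ ⁻¹ᵁ ⊤ := le_rfl
  have h2 : g.appLE (f ''ᵁ ⊤) ⊤ e = f.appLE (f ''ᵁ ⊤) ⊤ e' ≫ (Spec.map φ).appLE ⊤ ⊤ e'' := by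
    rw [Scheme.Hom.appLE_comp_appLE]
    subst h
    rfl
  have h3 : (f.appIso ⊤).inv ≫ f.appLE (f ''ᵁ ⊤) ⊤ e' = 𝟙 _ := by
    rw [Scheme.Hom.appIso_inv_appLE]
    exact CategoryTheory.Functor.map_id _ _
  have h4 : (Spec.map φ).appLE ⊤ ⊤ e'' = (Spec.map φ).appTop :=
    (Scheme.Hom.app_eq_appLE _).symm
  have h1 : X.presheaf.map (homOfLE hle).op =
      (f.appLE (f ''ᵁ ⊤) ⊤ e' ≫ (Spec.map φ).appTop) ≫ (g.appIso ⊤).inv := by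
    rw [← h4, ← h2, Scheme.Hom.appLE_appIso_inv]
  rw [h1, specSection, specSection, Category.assoc, Category.assoc, reassoc_of% h3,
    ← Scheme.ΓSpecIso_inv_naturality_assoc]

lemma mem_image_top (f : Spec A ⟶ X) [IsOpenImmersion f] (y : Spec A) : f y ∈ f ''ᵁ ⊤ :=
  ⟨y, trivial, rfl⟩

lemma stalkMap_germ_specSection (f : Spec A ⟶ X) [IsOpenImmersion f] (y : Spec A) (a : A) :
    f.stalkMap y (X.presheaf.germ (f ''ᵁ ⊤) (f y) (mem_image_top f y) (specSection f a)) =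
      StructureSheaf.toStalk A y a := by
  have h1 : specSection f ≫ f.app (f ''ᵁ ⊤) = (Scheme.ΓSpecIso A).inv ≫
      (Spec A).presheaf.map (eqToHom (f.preimage_image_eq ⊤)).op := by
    rw [specSection, Category.assoc, Scheme.Hom.appIso_inv_app]
  have h2 : specSection f ≫ X.presheaf.germ (f ''ᵁ ⊤) (f y) (mem_image_top f y) ≫ f.stalkMap y =
      StructureSheaf.toStalk A y := by
    rw [Scheme.Hom.germ_stalkMap, reassoc_of% h1]
    have h3 := TopCat.Presheaf.germ_res (Spec A).presheaf (eqToHom (f.preimage_image_eq ⊤)) y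
      (mem_image_top f y)
    exact congr((Scheme.ΓSpecIso A).inv ≫ $h3)
  exact congr($h2 a)

/-- The local ring of `X` at a point of an affine chart is a localization of the ring of the
chart. -/
lemma isLocalization_germ_specSection (f : Spec A ⟶ X) [IsOpenImmersion f] (y : Spec A) :
    letI := (specSection f ≫ X.presheaf.germ (f ''ᵁ ⊤) (f y) (mem_image_top f y)).hom.toAlgebra
    haveI : y.asIdeal.IsPrime := PrimeSpectrum.isPrime y
    IsLocalization.AtPrime (X.presheaf.stalk (f y)) y.asIdeal := by
  let _ : Algebra A (X.presheaf.stalk (f y)) :=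
    (specSection f ≫ X.presheaf.germ (f ''ᵁ ⊤) (f y) (mem_image_top f y)).hom.toAlgebra
  have : y.asIdeal.IsPrime := PrimeSpectrum.isPrime y
  let _ : Algebra A ((Spec A).presheaf.stalk y) := StructureSheaf.stalkAlgebra A y
  have hloc : IsLocalization.AtPrime ((Spec A).presheaf.stalk y) y.asIdeal :=
    StructureSheaf.IsLocalization.to_stalk A y
  let e : X.presheaf.stalk (f y) ≃+* (Spec A).presheaf.stalk y :=
    (asIso (f.stalkMap y)).commRingCatIsoToRingEquiv
  let e' : X.presheaf.stalk (f y) ≃ₐ[A] (Spec A).presheaf.stalk y :=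
    AlgEquiv.ofRingEquiv (f := e) (fun a => stalkMap_germ_specSection f y a)
  exact IsLocalization.isLocalization_of_algEquiv _ e'.symm

lemma isUnit_germ_specSection_iff (f : Spec A ⟶ X) [IsOpenImmersion f] (y : Spec A)
    (a : A) : IsUnit (X.presheaf.germ (f ''ᵁ ⊤) (f y) (mem_image_top f y) (specSection f a)) ↔
      a ∉ y.asIdeal := by
  have : y.asIdeal.IsPrime := PrimeSpectrum.isPrime y
  let _ := (specSection f ≫ X.presheaf.germ (f ''ᵁ ⊤) (f y) (mem_image_top f y)).hom.toAlgebra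
  have := isLocalization_germ_specSection f y
  exact IsLocalization.AtPrime.isUnit_to_map_iff (X.presheaf.stalk (f y)) y.asIdeal a

lemma span_germ_specSection (f : Spec A ⟶ X) [IsOpenImmersion f] (y : Spec A)
    {a : A} (ha : y.asIdeal = Ideal.span {a}) :
    Ideal.span {X.presheaf.germ (f ''ᵁ ⊤) (f y) (mem_image_top f y) (specSection f a)} =
      IsLocalRing.maximalIdeal (X.presheaf.stalk (f y)) := by
  have : y.asIdeal.IsPrime := PrimeSpectrum.isPrime y
  let _ := (specSection f ≫ X.presheaf.germ (f ''ᵁ ⊤) (f y) (mem_image_top f y)).hom.toAlgebra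
  have := isLocalization_germ_specSection f y
  rw [← IsLocalization.AtPrime.map_eq_maximalIdeal y.asIdeal (X.presheaf.stalk (f y)), ha,
    Ideal.map_span, Set.image_singleton]
  rfl

end AffineCharts

/-! ### The charts of a toric scheme -/

namespace ToricFan

variable {n : ℕ} (Δ : ToricFan n)

section Charts

variable (R : Type u) [CommRing R]

/-- The image `U_σ` of the chart of the cone `σ`, as an open subset of `X_Δ`. -/
def chartOpen (σ : Δ.ConeIndex) : (Δ.toricScheme R).Opens := (Δ.chart R σ) ''ᵁ ⊤

/-- The point of the affine toric scheme of `σ` given by a prime ideal. -/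
def primePoint (σ : Δ.ConeIndex) (p : Ideal (ConeRing R σ.1)) [hp : p.IsPrime] :
    Spec (CommRingCat.of (ConeRing R σ.1)) :=
  (⟨p, hp⟩ : PrimeSpectrum (ConeRing R σ.1))

variable {R} in
lemma mem_chartOpen {σ : Δ.ConeIndex} {x : Δ.toricScheme R} :
    x ∈ Δ.chartOpen R σ ↔ ∃ y, Δ.chart R σ y = x := by
  constructor
  · rintro ⟨y, -, h⟩; exact ⟨y, h⟩
  · rintro ⟨y, h⟩; exact ⟨y, trivial, h⟩

variable {R} in
lemma chart_mem_chartOpen (σ : Δ.ConeIndex) (y : Spec (CommRingCat.of (ConeRing R σ.1))) :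
    Δ.chart R σ y ∈ Δ.chartOpen R σ := Δ.mem_chartOpen.2 ⟨y, rfl⟩

lemma specMap_chart {τ σ : Δ.ConeIndex} (h : τ ≤ σ) :
    Spec.map (CommRingCat.ofHom (coneRingMap R h)) ≫ Δ.chart R σ = Δ.chart R τ :=
  colimit.w (Δ.chartDiagram R) (homOfLE h)

lemma chart_specMap {τ σ : Δ.ConeIndex} (h : τ ≤ σ)
    (y : Spec (CommRingCat.of (ConeRing R τ.1))) :
    Δ.chart R σ (Spec.map (CommRingCat.ofHom (coneRingMap R h)) y) = Δ.chart R τ y := by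
  rw [← Δ.specMap_chart R h]; rfl

lemma chartOpen_mono {τ σ : Δ.ConeIndex} (h : τ ≤ σ) : Δ.chartOpen R τ ≤ Δ.chartOpen R σ := by
  intro x hx
  obtain ⟨y, rfl⟩ := Δ.mem_chartOpen.1 hx
  exact Δ.mem_chartOpen.2 ⟨_, Δ.chart_specMap R h y⟩

/-- The elements of the ring of `σ`, seen as functions on the open subset `U_σ` of `X_Δ`. -/
def chartSection (σ : Δ.ConeIndex) : ConeRing R σ.1 →+* Γ(Δ.toricScheme R, Δ.chartOpen R σ) :=
  (specSection (Δ.chart R σ)).hom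

lemma chartSection_injective (σ : Δ.ConeIndex) : Function.Injective (Δ.chartSection R σ) := by
  have : IsIso (specSection (Δ.chart R σ)) := by unfold specSection; infer_instance
  exact (ConcreteCategory.bijective_of_isIso (specSection (Δ.chart R σ))).1

lemma map_chartSection {τ σ : Δ.ConeIndex} (h : τ ≤ σ) (a : ConeRing R σ.1) :
    (Δ.toricScheme R).presheaf.map (homOfLE (Δ.chartOpen_mono R h)).op (Δ.chartSection R σ a) =
      Δ.chartSection R τ (coneRingMap R h a) := by
  have h1 := specSection_map (Δ.chart R σ) (Δ.chart R τ)
    (CommRingCat.ofHom (coneRingMap R h)) (Δ.specMap_chart R h) (Δ.chartOpen_mono R h)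
  exact congr($h1 a)

/-- The germ at a point of `U_σ` of an element of the ring of `σ`. -/
def chartGerm (σ : Δ.ConeIndex) {x : Δ.toricScheme R} (hx : x ∈ Δ.chartOpen R σ) :
    ConeRing R σ.1 →+* (Δ.toricScheme R).presheaf.stalk x :=
  ((Δ.toricScheme R).presheaf.germ (Δ.chartOpen R σ) x hx).hom.comp (Δ.chartSection R σ)

lemma isUnit_chartGerm_iff (σ : Δ.ConeIndex) (y : Spec (CommRingCat.of (ConeRing R σ.1)))
    (a : ConeRing R σ.1) :
    IsUnit (Δ.chartGerm R σ (Δ.chart_mem_chartOpen σ y) a) ↔ a ∉ y.asIdeal :=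
  isUnit_germ_specSection_iff (Δ.chart R σ) y a

lemma span_chartGerm (σ : Δ.ConeIndex) (y : Spec (CommRingCat.of (ConeRing R σ.1)))
    {a : ConeRing R σ.1} (ha : y.asIdeal = Ideal.span {a}) :
    Ideal.span {Δ.chartGerm R σ (Δ.chart_mem_chartOpen σ y) a} =
      IsLocalRing.maximalIdeal ((Δ.toricScheme R).presheaf.stalk (Δ.chart R σ y)) :=
  span_germ_specSection (Δ.chart R σ) y ha

lemma coheight_chart (σ : Δ.ConeIndex) (y : Spec (CommRingCat.of (ConeRing R σ.1))) :
    Order.coheight (Δ.chart R σ y) = y.asIdeal.height := by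
  rw [idealHeight_eq_coheight]
  exact coheight_eq_of_isOpenImmersion (Δ.chart R σ)

lemma chart_specializes_iff (σ : Δ.ConeIndex) (y z : Spec (CommRingCat.of (ConeRing R σ.1))) :
    Δ.chart R σ y ⤳ Δ.chart R σ z ↔ y.asIdeal ≤ z.asIdeal :=
  (Δ.chart R σ).isOpenEmbedding.isInducing.specializes_iff.trans
    (PrimeSpectrum.le_iff_specializes _ _).symm

lemma chart_injective (σ : Δ.ConeIndex) : Function.Injective (Δ.chart R σ) :=
  (Δ.chart R σ).isOpenEmbedding.injective

/-- A point in two charts lies in the chart of a common face of their cones. -/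
lemma exists_specMap_eq_of_chart_eq {σ τ : Δ.ConeIndex}
    {y : Spec (CommRingCat.of (ConeRing R σ.1))} {z : Spec (CommRingCat.of (ConeRing R τ.1))}
    (h : Δ.chart R σ y = Δ.chart R τ z) :
    ∃ (ρ : Δ.ConeIndex) (hσ : ρ ≤ σ) (_ : ρ ≤ τ) (w : Spec (CommRingCat.of (ConeRing R ρ.1))),
      Spec.map (CommRingCat.ofHom (coneRingMap R hσ)) w = y := by
  obtain ⟨ρ, f, g, w, hw, -⟩ :=
    (Scheme.IsLocallyDirected.ι_eq_ι_iff (Δ.chartDiagram R)).1 h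
  exact ⟨ρ, f.le, g.le, w, hw⟩

variable [IsDomain R] (hbot : ⊥ ∈ Δ.cones)

/-- The zero cone, as an element of the fan; its chart is the torus. -/
def zeroCone : Δ.ConeIndex := ⟨⊥, hbot⟩

lemma zeroCone_le (σ : Δ.ConeIndex) : Δ.zeroCone hbot ≤ σ := (bot_le : ⊥ ≤ σ.1)

instance nonempty_chartOpen (σ : Δ.ConeIndex) : Nonempty (Δ.chartOpen R σ) :=
  ⟨⟨Δ.chart R σ (Δ.primePoint R σ ⊥), Δ.chart_mem_chartOpen σ _⟩⟩

/-- A Laurent polynomial, as a rational function on `X_Δ`. -/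
def torusFunction :
    ConeRing R (⊥ : PointedCone ℝ (Fin n → ℝ)) →+* (Δ.toricScheme R).functionField :=
  ((Δ.toricScheme R).germToFunctionField (Δ.chartOpen R (Δ.zeroCone hbot))).hom.comp
    (Δ.chartSection R (Δ.zeroCone hbot))

lemma torusFunction_injective : Function.Injective (Δ.torusFunction R hbot) :=
  (Scheme.germToFunctionField_injective _ _).comp (Δ.chartSection_injective R (Δ.zeroCone hbot))

/-- The germs of the functions on `U_σ` are compatible with their expansions as Laurent
polynomials. -/
lemma algebraMap_chartGerm (σ : Δ.ConeIndex) {x : Δ.toricScheme R} (hx : x ∈ Δ.chartOpen R σ)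
    (a : ConeRing R σ.1) :
    algebraMap _ (Δ.toricScheme R).functionField (Δ.chartGerm R σ hx a) =
      Δ.torusFunction R hbot (coneRingMap R bot_le a) := by
  have hle := Δ.chartOpen_mono R (Δ.zeroCone_le hbot σ)
  have h2 : algebraMap _ (Δ.toricScheme R).functionField (Δ.chartGerm R σ hx a) =
      (Δ.toricScheme R).germToFunctionField (Δ.chartOpen R σ) (Δ.chartSection R σ a) :=
    Scheme.algebraMap_germ_eq_germToFunctionField _ hx _
  have h3 : (Δ.toricScheme R).presheaf.map (homOfLE hle).op ≫
      (Δ.toricScheme R).germToFunctionField (Δ.chartOpen R (Δ.zeroCone hbot)) =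
      (Δ.toricScheme R).germToFunctionField (Δ.chartOpen R σ) :=
    TopCat.Presheaf.germ_res _ _ _ _
  rw [h2, ← h3]
  exact congrArg ((Δ.toricScheme R).germToFunctionField (Δ.chartOpen R (Δ.zeroCone hbot)))
    (Δ.map_chartSection R (Δ.zeroCone_le hbot σ) a)

end Charts

end ToricFan

/-! ### The torus-fixed points -/

/-- A prime of height one of `R[S]` that contains a monomial is spanned by monomials. In
particular its elements have no constant term. -/
lemma coeff_zero_eq_zero_of_height_eq_one {R S : Type*} [CommRing R] [AddCommMonoid S]
    [IsDomain (AddMonoidAlgebra R S)] {p : Ideal (AddMonoidAlgebra R S)} [hp : p.IsPrime]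
    (h1 : p.height = 1) {m : S} (hm : AddMonoidAlgebra.single m 1 ∈ p)
    {x : AddMonoidAlgebra R S} (hx : x ∈ p) : x.coeff 0 = 0 := by
  have hone : AddMonoidAlgebra.single (0 : S) (1 : R) = 1 := AddMonoidAlgebra.one_def.symm
  have hadd : ∀ a b : S, AddMonoidAlgebra.single (a + b) (1 : R) =
      AddMonoidAlgebra.single a 1 * AddMonoidAlgebra.single b 1 := fun a b => by
    rw [AddMonoidAlgebra.single_mul_single, mul_one]
  -- The exponents of the monomials outside `p` form a face.
  let F : AddSubmonoid S :=
    { carrier := {a | AddMonoidAlgebra.single a (1 : R) ∉ p}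
      zero_mem' := fun h => hp.ne_top ((Ideal.eq_top_iff_one p).2 (hone ▸ h))
      add_mem' := fun {a b} ha hb h => by
        rw [hadd] at h
        exact (hp.mem_or_mem h).elim ha hb }
  have hF : ∀ a b, a + b ∈ F → a ∈ F ∧ b ∈ F := fun a b hab =>
    ⟨fun h => hab (by rw [hadd]; exact p.mul_mem_right _ h),
      fun h => hab (by rw [hadd]; exact p.mul_mem_left _ h)⟩
  have hle : faceIdeal F hF ≤ p := fun y hy => mem_of_forall_single_mem fun a ha => by
    by_contra h
    exact ha (mem_faceIdeal.1 hy a h)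
  have hmem : AddMonoidAlgebra.single m (1 : R) ∈ faceIdeal F hF :=
    mem_faceIdeal.2 fun a ha => by
      rw [AddMonoidAlgebra.coeff_single, Finsupp.single_eq_of_ne]
      rintro rfl
      exact ha hm
  have hnt : Nontrivial R := by
    by_contra h
    have := not_nontrivial_iff_subsingleton.1 h
    have h01 : (1 : AddMonoidAlgebra R S) = 0 := by
      rw [← hone, Subsingleton.elim (1 : R) 0, AddMonoidAlgebra.single_zero]
    exact one_ne_zero h01
  have hne : faceIdeal (R := R) F hF ≠ ⊥ := fun h => by
    rw [h, Ideal.mem_bot, AddMonoidAlgebra.single_eq_zero] at hmem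
    exact one_ne_zero hmem
  have hfin : (faceIdeal (R := R) F hF).FiniteHeight := by
    rw [Ideal.finiteHeight_iff]
    exact .inr (ne_top_of_le_ne_top (h1 ▸ ENat.one_ne_top) (Ideal.height_mono hle))
  have heq : faceIdeal F hF = p := by
    refine Ideal.eq_of_le_of_height_le _ hle ?_
    rw [h1, Order.one_le_iff_pos, pos_iff_ne_zero]
    exact fun h => hne (Ideal.height_eq_zero_iff_eq_bot.1 h)
  rw [← heq] at hx
  exact mem_faceIdeal.1 hx 0 F.zero_mem

section ConstantCoeff

variable {n : ℕ} {σ : PointedCone ℝ (Fin n → ℝ)}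

/-- The monoid of lattice points of the dual of a full-dimensional cone has no nonzero unit. -/
lemma dualMonoid_eq_zero_of_add_eq_zero (hσ : coneDim σ = n) {a b : dualMonoid σ}
    (h : a + b = 0) : a = 0 ∧ b = 0 := by
  have hab : ∀ v, latticePairing a.1 v + latticePairing b.1 v = 0 := fun v => by
    rw [← latticePairing_add_left]
    have : a.1 + b.1 = 0 := congrArg Subtype.val h
    rw [this]; simp [latticePairing]
  have ha : a.1 = 0 := eq_zero_of_latticePairing_eq_zero hσ fun v hv => by
    have h1 := a.2 v hv
    have h2 := b.2 v hv
    have h3 := hab v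
    linarith
  have ha' : a = 0 := Subtype.ext ha
  exact ⟨ha', by rwa [ha', zero_add] at h⟩

variable (R : Type u) [CommRing R]

open Classical in
/-- The value at the torus-fixed point of a function on the affine toric scheme of a
full-dimensional cone, i.e. the constant term. -/
def constantCoeff (hσ : coneDim σ = n) : ConeRing R σ →+* R :=
  (AddMonoidAlgebra.lift R R (dualMonoid σ)
    { toFun := fun m => if m.toAdd = 0 then 1 else 0
      map_one' := by rw [toAdd_one, if_pos rfl]
      map_mul' := by
        intro a b
        rw [toAdd_mul]
        by_cases h : a.toAdd + b.toAdd = 0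
        · obtain ⟨ha, hb⟩ := dualMonoid_eq_zero_of_add_eq_zero hσ h
          rw [if_pos h, if_pos ha, if_pos hb, mul_one]
        · rw [if_neg h]
          by_cases ha : a.toAdd = 0
          · have hb : b.toAdd ≠ 0 := fun hb => h (by rw [ha, hb, add_zero])
            rw [if_neg hb, mul_zero]
          · rw [if_neg ha, zero_mul] }).toRingHom

lemma constantCoeff_apply (hσ : coneDim σ = n) (x : ConeRing R σ) :
    constantCoeff R hσ x = x.coeff 0 := by
  classical
  induction x using AddMonoidAlgebra.induction_linear with
  | zero => simp
  | add x y hx hy => rw [map_add, hx, hy, AddMonoidAlgebra.coeff_add, Finsupp.add_apply]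
  | single a r =>
    have h1 : constantCoeff R hσ (AddMonoidAlgebra.single a r) = r • (if a = 0 then 1 else 0) :=
      AddMonoidAlgebra.lift_single _ _ _
    rw [h1, AddMonoidAlgebra.coeff_single, Finsupp.single_apply]
    simp

lemma constantCoeff_comp_algebraMap (hσ : coneDim σ = n) :
    (constantCoeff R hσ).comp (algebraMap R (ConeRing R σ)) = RingHom.id R :=
  RingHom.ext fun r => (AddMonoidAlgebra.lift R R (dualMonoid σ) _).commutes r

end ConstantCoeff

namespace ToricFan

variable {n : ℕ} (Δ : ToricFan n) (K : Type u) [Field K]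

/-- The torus-fixed point in the affine toric variety of a full-dimensional cone. -/
def fixedPrime (σ : Δ.ConeIndex) (hσ : coneDim σ.1 = n) :
    Spec (CommRingCat.of (ConeRing K σ.1)) :=
  Δ.primePoint K σ (hp := RingHom.ker_isPrime (constantCoeff K hσ))
    (RingHom.ker (constantCoeff K hσ))

/-- The torus-fixed point `γ_σ` of `X_Δ` of a full-dimensional cone `σ`. -/
def fixedPoint (σ : Δ.ConeIndex) (hσ : coneDim σ.1 = n) : Δ.toricScheme K :=
  Δ.chart K σ (Δ.fixedPrime K σ hσ)

variable {K}

lemma mem_fixedPrime {σ : Δ.ConeIndex} {hσ : coneDim σ.1 = n} {a : ConeRing K σ.1} :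
    a ∈ (Δ.fixedPrime K σ hσ).asIdeal ↔ a.coeff 0 = 0 := by
  rw [← constantCoeff_apply K hσ]; exact Iff.rfl

end ToricFan

/-! ### Equations of divisors that avoid the torus-fixed points -/

namespace ToricFan

variable {n : ℕ} (Δ : ToricFan n) {K : Type u} [Field K] (hbot : ⊥ ∈ Δ.cones)

lemma coneRingMap_self {R : Type u} [CommRing R] {σ : PointedCone ℝ (Fin n → ℝ)} (h : σ ≤ σ)
    (x : ConeRing R σ) : coneRingMap R h x = x := by
  induction x using AddMonoidAlgebra.induction_linear with
  | zero => simp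
  | add x y hx hy => rw [map_add, hx, hy]
  | single a r => rw [coneRingMap_single]; rfl

lemma ord_torusFunction_eq_zero (σ : Δ.ConeIndex) {y : Spec (CommRingCat.of (ConeRing K σ.1))}
    {a : ConeRing K σ.1} (ha : a ∉ y.asIdeal) :
    (Δ.toricScheme K).ord (Δ.torusFunction K hbot (coneRingMap K bot_le a))
      (Δ.chart K σ y) = 0 := by
  rw [← Δ.algebraMap_chartGerm K hbot σ (Δ.chart_mem_chartOpen σ y)]
  exact Scheme.ord_algebraMap_of_isUnit ((Δ.isUnit_chartGerm_iff K σ y a).2 ha)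

lemma torusFunction_ne_zero {a : ConeRing K (⊥ : PointedCone ℝ (Fin n → ℝ))} (ha : a ≠ 0) :
    Δ.torusFunction K hbot a ≠ 0 :=
  (map_ne_zero_iff _ (Δ.torusFunction_injective K hbot)).2 ha

/-- The torus is factorial: each of its prime divisors has an equation. -/
lemma exists_torus_equation {y : Spec (CommRingCat.of (ConeRing K (Δ.zeroCone hbot).1))}
    (hy : Order.coheight (Δ.chart K (Δ.zeroCone hbot) y) = 1) :
    ∃ π : ConeRing K (⊥ : PointedCone ℝ (Fin n → ℝ)), π ≠ 0 ∧ y.asIdeal = Ideal.span {π} ∧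
      (Δ.toricScheme K).ord (Δ.torusFunction K hbot π) (Δ.chart K (Δ.zeroCone hbot) y) = 1 ∧
      ∀ z : Spec (CommRingCat.of (ConeRing K (Δ.zeroCone hbot).1)),
        Order.coheight (Δ.chart K (Δ.zeroCone hbot) z) = 1 → z ≠ y →
          (Δ.toricScheme K).ord (Δ.torusFunction K hbot π) (Δ.chart K (Δ.zeroCone hbot) z) = 0 := by
  have hy1 : y.asIdeal.height = 1 := by rw [← Δ.coheight_chart, hy]
  have : y.asIdeal.IsPrime := PrimeSpectrum.isPrime y
  have hufd : UniqueFactorizationMonoid (ConeRing K (Δ.zeroCone hbot).1) :=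
    coneRing_bot_uniqueFactorizationMonoid K
  obtain ⟨π, hπ⟩ := UniqueFactorizationMonoid.isPrincipal_of_height_eq_one hy1
  have hπ' : y.asIdeal = Ideal.span {π} := hπ
  have hne : π ≠ 0 := by
    rintro rfl
    refine Ideal.ne_bot_of_height_eq_one hy1 (hπ'.trans ?_)
    exact Ideal.span_singleton_eq_bot.2 rfl
  have hmap : coneRingMap K (bot_le : ⊥ ≤ (Δ.zeroCone hbot).1) π = π := coneRingMap_self _ π
  refine ⟨π, hne, hπ', ?_, fun z hz hzy => ?_⟩
  · have h1 := Δ.algebraMap_chartGerm K hbot _ (Δ.chart_mem_chartOpen (Δ.zeroCone hbot) y) π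
    rw [hmap] at h1
    rw [← h1]
    refine Scheme.ord_algebraMap_of_span_eq_maximalIdeal hy (fun h0 => ?_)
      (Δ.span_chartGerm K _ y hπ')
    rw [h0, map_zero] at h1
    exact Δ.torusFunction_ne_zero hbot hne h1.symm
  · have h1 := Δ.ord_torusFunction_eq_zero hbot (Δ.zeroCone hbot) (y := z) (a := π)
      (fun hmem => hzy ?_)
    · rwa [hmap] at h1
    · have hz1 : z.asIdeal.height = 1 := by rw [← Δ.coheight_chart, hz]
      have hle : y.asIdeal ≤ z.asIdeal := by
        rw [hπ']; exact (Ideal.span_singleton_le_iff_mem _).2 hmem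
      have hfin : y.asIdeal.FiniteHeight := by
        rw [Ideal.finiteHeight_iff, hy1]; exact .inr ENat.one_ne_top
      exact (PrimeSpectrum.ext
        (Ideal.eq_of_le_of_height_le _ hle (by rw [hz1, hy1]))).symm

/-- The Laurent polynomial `f` is on `U_σ`, for each full-dimensional cone `σ` and up to a
character, a function that does not vanish at the torus-fixed point. -/
def IsUnitAtFixedPoints (f : ConeRing K (⊥ : PointedCone ℝ (Fin n → ℝ))) : Prop :=
  ∀ σ : Δ.ConeIndex, coneDim σ.1 = n → ∃ (m : Fin n → ℤ) (y : ConeRing K σ.1),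
    y.coeff 0 ≠ 0 ∧ coneRingMap K bot_le y = f * torusChar K (-m)

lemma isUnitAtFixedPoints_one : Δ.IsUnitAtFixedPoints (K := K) 1 := by
  refine fun σ hσ => ⟨0, 1, ?_, ?_⟩
  · rw [← constantCoeff_apply K hσ, map_one]; exact one_ne_zero
  · rw [map_one, neg_zero, torusChar_zero, mul_one]

variable {Δ} in
lemma IsUnitAtFixedPoints.mul {f g : ConeRing K (⊥ : PointedCone ℝ (Fin n → ℝ))}
    (hf : Δ.IsUnitAtFixedPoints f) (hg : Δ.IsUnitAtFixedPoints g) :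
    Δ.IsUnitAtFixedPoints (f * g) := by
  intro σ hσ
  obtain ⟨a, y, hy, hya⟩ := hf σ hσ
  obtain ⟨b, z, hz, hzb⟩ := hg σ hσ
  rw [← constantCoeff_apply K hσ] at hy hz
  refine ⟨a + b, y * z, ?_, ?_⟩
  · rw [← constantCoeff_apply K hσ, map_mul]; exact mul_ne_zero hy hz
  · rw [map_mul, hya, hzb, neg_add, torusChar_add]; ring

variable {Δ} in
lemma IsUnitAtFixedPoints.pow {f : ConeRing K (⊥ : PointedCone ℝ (Fin n → ℝ))}
    (hf : Δ.IsUnitAtFixedPoints f) (k : ℕ) : Δ.IsUnitAtFixedPoints (f ^ k) := by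
  induction k with
  | zero => rw [pow_zero]; exact Δ.isUnitAtFixedPoints_one
  | succ k ih => rw [pow_succ]; exact ih.mul hf

/-- The equation of a prime divisor of the torus whose closure does not contain the torus-fixed
points. -/
lemma isUnitAtFixedPoints_of_span {y : Spec (CommRingCat.of (ConeRing K (Δ.zeroCone hbot).1))}
    {π : ConeRing K (⊥ : PointedCone ℝ (Fin n → ℝ))} (hπ : y.asIdeal = Ideal.span {π})
    (h : ∀ (σ : Δ.ConeIndex) (hσ : coneDim σ.1 = n),
      Δ.fixedPoint K σ hσ ∉ closure {Δ.chart K (Δ.zeroCone hbot) y}) :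
    Δ.IsUnitAtFixedPoints π := by
  intro σ hσ
  have h1 := h σ hσ
  rw [← specializes_iff_mem_closure, ← Δ.chart_specMap K (Δ.zeroCone_le hbot σ), fixedPoint,
    chart_specializes_iff] at h1
  obtain ⟨x, hx, hx0⟩ := Set.not_subset.1 h1
  have hx' : coneRingMap K bot_le x ∈ y.asIdeal := hx
  rw [hπ] at hx'
  obtain ⟨g, hg⟩ := Ideal.mem_span_singleton.1 hx'
  exact exists_mul_torusChar_eq K (fun h0 => hx0 (Δ.mem_fixedPrime.2 h0)) hg.symm

variable {Δ} in
/-- An effective divisor that avoids the torus-fixed points has on the torus an equation that is, up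
to characters, a unit at each of them. -/
lemma exists_torus_divisor_equation {D : WeilDivisor (Δ.toricScheme K)} (hD : D.IsEffective)
    (h : ∀ (σ : Δ.ConeIndex) (hσ : coneDim σ.1 = n), Δ.fixedPoint K σ hσ ∉ D.support) :
    ∃ f : ConeRing K (⊥ : PointedCone ℝ (Fin n → ℝ)), f ≠ 0 ∧ Δ.IsUnitAtFixedPoints f ∧
      ∀ y, D.coeff (Δ.chart K (Δ.zeroCone hbot) y) =
        (Δ.toricScheme K).ord (Δ.torusFunction K hbot f) (Δ.chart K (Δ.zeroCone hbot) y) := by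
  classical
  set T := Δ.chart K (Δ.zeroCone hbot)
  have hfin : {y | D.coeff (T y) ≠ 0}.Finite := by
    have h1 : IsCompact (Set.range T) := isCompact_range T.continuous
    have h2 :=
      (Function.locallyFinsupp.locallyFiniteSupport D.1).finite_inter_support_of_isCompact h1
    refine (h2.preimage (Δ.chart_injective K (Δ.zeroCone hbot)).injOn).subset fun y hy => ?_
    exact ⟨⟨y, rfl⟩, hy⟩
  have hcoh : ∀ y, D.coeff (T y) ≠ 0 → Order.coheight (T y) = 1 := fun y hy => D.2 _ hy
  have hex : ∀ y, ∃ π : ConeRing K (⊥ : PointedCone ℝ (Fin n → ℝ)), π ≠ 0 ∧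
      (D.coeff (T y) ≠ 0 → Δ.IsUnitAtFixedPoints π ∧
        (Δ.toricScheme K).ord (Δ.torusFunction K hbot π) (T y) = 1 ∧
        ∀ z, Order.coheight (T z) = 1 → z ≠ y →
          (Δ.toricScheme K).ord (Δ.torusFunction K hbot π) (T z) = 0) := by
    intro y
    by_cases hy : D.coeff (T y) = 0
    · exact ⟨1, one_ne_zero, fun h => absurd hy h⟩
    · obtain ⟨π, h0, hπ, h1, h2⟩ := Δ.exists_torus_equation hbot (hcoh y hy)
      refine ⟨π, h0, fun _ => ⟨Δ.isUnitAtFixedPoints_of_span hbot hπ fun σ hσ hmem => ?_, h1, h2⟩⟩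
      exact h σ hσ (Set.mem_biUnion hy hmem)
  choose π h0 hπ using hex
  set s := hfin.toFinset
  have hs : ∀ y, y ∈ s ↔ D.coeff (T y) ≠ 0 := fun y => hfin.mem_toFinset
  refine ⟨∏ y ∈ s, π y ^ (D.coeff (T y)).toNat, ?_, ?_, fun y => ?_⟩
  · exact Finset.prod_ne_zero_iff.2 fun y _ => pow_ne_zero _ (h0 y)
  · refine Finset.prod_induction _ Δ.IsUnitAtFixedPoints (fun _ _ ha hb => ha.mul hb)
      Δ.isUnitAtFixedPoints_one fun y hy => ?_
    exact (hπ y ((hs y).1 hy)).1.pow _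
  · by_cases hy : Order.coheight (T y) = 1
    · have hne : ∀ z, Δ.torusFunction K hbot (π z) ≠ 0 := fun z =>
        Δ.torusFunction_ne_zero hbot (h0 z)
      rw [map_prod, Scheme.ord_prod _ _ (fun z _ => by rw [map_pow]; exact pow_ne_zero _ (hne z))]
      have hterm : ∀ z ∈ s, (Δ.toricScheme K).ord
          (Δ.torusFunction K hbot (π z ^ (D.coeff (T z)).toNat)) (T y) =
          if y = z then D.coeff (T y) else 0 := by
        intro z hz
        obtain ⟨-, h1, h2⟩ := hπ z ((hs z).1 hz)
        rw [map_pow, Scheme.ord_pow (hne z)]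
        split_ifs with hyz
        · subst hyz
          rw [h1, mul_one, Int.toNat_of_nonneg (hD _)]
        · rw [h2 y hy hyz, mul_zero]
      rw [Finset.sum_congr rfl hterm, Finset.sum_ite_eq]
      split_ifs with hys
      · rfl
      · by_contra h; exact hys ((hs y).2 h)
    · rw [Scheme.ord_eq_zero_of_coheight_neq_one hy]
      by_contra h
      exact hy (hcoh y h)

/-- A point of codimension one of `U_σ` outside of the torus is the generic point of a
toric divisor, and specializes to the torus-fixed point. -/
lemma chart_specializes_fixedPoint {σ : Δ.ConeIndex} (hσ : coneDim σ.1 = n)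
    {y : Spec (CommRingCat.of (ConeRing K σ.1))} (hy : Order.coheight (Δ.chart K σ y) = 1)
    (hT : Δ.chart K σ y ∉ Δ.chartOpen K (Δ.zeroCone hbot)) :
    Δ.chart K σ y ⤳ Δ.fixedPoint K σ hσ := by
  obtain ⟨m, hm, hface⟩ := Δ.isConeFace_of_le hbot σ.2 bot_le
  have h1 := Δ.range_chartDiagram_map K (homOfLE (Δ.zeroCone_le hbot σ)) hm hface
  have hmem : coneChar K ⟨m, hm⟩ ∈ y.asIdeal := by
    by_contra hmem
    have h2 : y ∈ Set.range ((Δ.chartDiagram K).map (homOfLE (Δ.zeroCone_le hbot σ))) := by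
      rw [h1]; exact hmem
    obtain ⟨z, rfl⟩ := h2
    exact hT (Δ.mem_chartOpen.2 ⟨z, (Δ.chart_specMap K (Δ.zeroCone_le hbot σ) z).symm⟩)
  rw [fixedPoint, chart_specializes_iff]
  intro x hx
  rw [mem_fixedPrime]
  have : y.asIdeal.IsPrime := PrimeSpectrum.isPrime y
  exact coeff_zero_eq_zero_of_height_eq_one (by rw [← Δ.coheight_chart, hy]) hmem hx

variable {Δ} in
/-- If an effective divisor avoids the torus-fixed points, then its equation on the torus is, up to
characters, an equation of the divisor on all the charts of the full-dimensional cones. -/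
lemma coeff_eq_ord_of_mem_chartOpen {D : WeilDivisor (Δ.toricScheme K)}
    {σ : Δ.ConeIndex} (hσ : coneDim σ.1 = n) (h : Δ.fixedPoint K σ hσ ∉ D.support)
    {f : ConeRing K (⊥ : PointedCone ℝ (Fin n → ℝ))} (hf0 : f ≠ 0)
    (hf : ∀ y, D.coeff (Δ.chart K (Δ.zeroCone hbot) y) =
      (Δ.toricScheme K).ord (Δ.torusFunction K hbot f) (Δ.chart K (Δ.zeroCone hbot) y))
    {m : Fin n → ℤ} {g : ConeRing K σ.1} (hg : g.coeff 0 ≠ 0)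
    (hgf : coneRingMap K bot_le g = f * torusChar K (-m)) {x : Δ.toricScheme K}
    (hx : x ∈ Δ.chartOpen K σ) :
    D.coeff x = (Δ.toricScheme K).ord (Δ.torusFunction K hbot (f * torusChar K (-m))) x := by
  by_cases hT : x ∈ Δ.chartOpen K (Δ.zeroCone hbot)
  · obtain ⟨y, rfl⟩ := Δ.mem_chartOpen.1 hT
    have hchar : (Δ.toricScheme K).ord (Δ.torusFunction K hbot (torusChar K (-m)))
        (Δ.chart K (Δ.zeroCone hbot) y) = 0 := by
      have h1 := Δ.ord_torusFunction_eq_zero hbot (Δ.zeroCone hbot) (y := y)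
        (a := torusChar K (-m)) (fun hmem => (PrimeSpectrum.isPrime y).ne_top
          (Ideal.eq_top_of_isUnit_mem _ hmem (isUnit_torusChar K (-m))))
      rwa [show coneRingMap K (bot_le : ⊥ ≤ (Δ.zeroCone hbot).1) (torusChar K (-m)) =
        torusChar K (-m) from coneRingMap_self _ _] at h1
    rw [map_mul, Scheme.ord_mul (Δ.torusFunction_ne_zero hbot hf0)
      (Δ.torusFunction_ne_zero hbot (isUnit_torusChar K (-m)).ne_zero), hchar, add_zero, hf]
  · obtain ⟨y, rfl⟩ := Δ.mem_chartOpen.1 hx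
    by_cases hy : Order.coheight (Δ.chart K σ y) = 1
    · have hspec := Δ.chart_specializes_fixedPoint hbot hσ hy hT
      have h1 : D.coeff (Δ.chart K σ y) = 0 := by
        by_contra h1
        exact h (Set.mem_biUnion h1 hspec.mem_closure)
      rw [h1, ← hgf, Δ.ord_torusFunction_eq_zero hbot σ]
      intro hmem
      rw [fixedPoint, chart_specializes_iff] at hspec
      exact hg (Δ.mem_fixedPrime.1 (hspec hmem))
    · rw [Scheme.ord_eq_zero_of_coheight_neq_one hy]
      by_contra h1
      exact hy (D.2 _ h1)

end ToricFan

/-! ### Divisors that avoid the torus-fixed points are Cartier and nef -/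

section Stalks

/-- The inclusion of the local rings in the function field is compatible with
generization. -/
lemma algebraMap_stalkSpecializes {X : Scheme.{u}} [IsIntegral X] {x y : X} (h : x ⤳ y)
    (s : X.presheaf.stalk y) :
    algebraMap _ X.functionField (X.presheaf.stalkSpecializes h s) =
      algebraMap _ X.functionField s := by
  have h1 := X.presheaf.stalkSpecializes_comp (genericPoint_specializes x) h
  exact congr($h1 s)

end Stalks

namespace ToricFan

variable {n : ℕ} {Δ : ToricFan n} {K : Type u} [Field K]

variable (Δ K) in
lemma exists_mem_chartOpen (hcompl : Δ.IsComplete) (x : Δ.toricScheme K) :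
    ∃ σ : Δ.ConeIndex, coneDim σ.1 = n ∧ x ∈ Δ.chartOpen K σ := by
  obtain ⟨τ, y, rfl⟩ := Δ.exists_chart_eq K x
  obtain ⟨σ, hσ, hle⟩ := Δ.exists_le_conesOfDim hcompl τ.2
  exact ⟨⟨σ, hσ.1⟩, hσ.2, Δ.chartOpen_mono K (show τ ≤ ⟨σ, hσ.1⟩ from hle)
    (Δ.chart_mem_chartOpen τ y)⟩

/-- Local equations of an effective divisor that avoids the torus-fixed points: a Laurent
polynomial `f` such that on each `U_σ`, `σ` of full dimension, the divisor is defined by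
`f χ^{-m}`, where `m = m_σ` is the exponent of `f` at which the elements of `σ` are minimal. -/
lemma exists_local_equations (hcompl : Δ.IsComplete) {D : WeilDivisor (Δ.toricScheme K)}
    (hD : D.IsEffective)
    (h : ∀ (σ : Δ.ConeIndex) (hσ : coneDim σ.1 = n), Δ.fixedPoint K σ hσ ∉ D.support) :
    ∃ f : ConeRing K (⊥ : PointedCone ℝ (Fin n → ℝ)), f ≠ 0 ∧
      ∀ σ : Δ.ConeIndex, coneDim σ.1 = n → ∃ (m : Fin n → ℤ) (g : ConeRing K σ.1),
        g.coeff 0 ≠ 0 ∧ coneRingMap K bot_le g = f * torusChar K (-m) ∧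
        ∀ x ∈ Δ.chartOpen K σ, D.coeff x = (Δ.toricScheme K).ord
          (Δ.torusFunction K (Δ.bot_mem_cones hcompl) (f * torusChar K (-m))) x := by
  obtain ⟨f, hf0, hf, hfD⟩ := exists_torus_divisor_equation (Δ.bot_mem_cones hcompl) hD h
  refine ⟨f, hf0, fun σ hσ => ?_⟩
  obtain ⟨m, g, hg, hgf⟩ := hf σ hσ
  exact ⟨m, g, hg, hgf, fun x hx =>
    coeff_eq_ord_of_mem_chartOpen (Δ.bot_mem_cones hcompl) hσ (h σ hσ) hf0 hfD hg hgf hx⟩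

/-- The exponent of `f` at which the elements of `σ` are minimal differs from any other exponent of
`f`, in particular from the one attached to another cone `τ`, by an element of the dual cone. -/
lemma sub_mem_dualMonoid {f : ConeRing K (⊥ : PointedCone ℝ (Fin n → ℝ))}
    {σ τ : PointedCone ℝ (Fin n → ℝ)} {a b : Fin n → ℤ} {g : ConeRing K σ} {h : ConeRing K τ}
    (hg : coneRingMap K bot_le g = f * torusChar K (-a)) (hh0 : h.coeff 0 ≠ 0)
    (hh : coneRingMap K bot_le h = f * torusChar K (-b)) : b - a ∈ dualMonoid σ := by
  have hb : f.coeff ⟨b, mem_dualMonoid_bot b⟩ ≠ 0 := by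
    have h1 := coeff_coneRingMap K (bot_le : ⊥ ≤ τ) h 0
    rw [hh, map_zero] at h1
    have h2 := coeff_mul_torusChar K f (-b) 0
    have h3 := h2.symm.trans h1
    simp only [zero_sub, neg_neg] at h3
    rwa [h3]
  refine mem_of_coeff_coneRingMap_ne_zero K (bot_le : ⊥ ≤ σ) (x := g)
    (m := ⟨b - a, mem_dualMonoid_bot _⟩) ?_
  rw [hg, coeff_mul_torusChar]
  simpa using hb

lemma isLocalEquation_one {D : WeilDivisor (Δ.toricScheme K)} {σ : Δ.ConeIndex}
    {g : (Δ.toricScheme K).functionField} (hg : g ≠ 0)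
    (h : ∀ x ∈ Δ.chartOpen K σ, D.coeff x = (Δ.toricScheme K).ord g x)
    {p : Δ.toricScheme K} (hp : p ∈ Δ.chartOpen K σ) : D.IsLocalEquation 1 p g :=
  ⟨hg, Δ.chartOpen K σ, hp, fun x hx => by rw [one_mul, h x hx]⟩

theorem isCartier_of_fixedPoint_notMem (hcompl : Δ.IsComplete) {D : WeilDivisor (Δ.toricScheme K)}
    (hD : D.IsEffective)
    (h : ∀ (σ : Δ.ConeIndex) (hσ : coneDim σ.1 = n), Δ.fixedPoint K σ hσ ∉ D.support) :
    D.IsCartier := by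
  intro p
  obtain ⟨f, hf0, hf⟩ := exists_local_equations hcompl hD h
  obtain ⟨σ, hσ, hp⟩ := Δ.exists_mem_chartOpen K hcompl p
  obtain ⟨m, g, hg, hgf, heq⟩ := hf σ hσ
  exact ⟨_, isLocalEquation_one (Δ.torusFunction_ne_zero _
    (mul_ne_zero hf0 (isUnit_torusChar K (-m)).ne_zero)) heq hp⟩

/-- An effective divisor `D` that avoids the torus-fixed points is base point free: the quotients
`χ^{m_σ - m_τ}` of its equations on the charts are regular on `U_τ`. So for every curve `C` the
divisor is equivalent to an effective one that does not contain `C`. -/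
theorem isNef_of_fixedPoint_notMem (hcompl : Δ.IsComplete) {D : WeilDivisor (Δ.toricScheme K)}
    (hD : D.IsEffective)
    (h : ∀ (σ : Δ.ConeIndex) (hσ : coneDim σ.1 = n), Δ.fixedPoint K σ hσ ∉ D.support) :
    D.IsNef (Δ.structureMap K) := by
  intro C i _ _ _ _
  set hbot := Δ.bot_mem_cones hcompl
  obtain ⟨f, hf0, hf⟩ := exists_local_equations hcompl hD h
  choose σ hσ hmem using fun p : C => Δ.exists_mem_chartOpen K hcompl (i p)
  choose m g hg hgf heq using fun p : C => hf (σ p) (hσ p)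
  let η : C := genericPoint C
  have hsub : ∀ p q : C, m q - m p ∈ dualMonoid (σ p).1 := fun p q =>
    sub_mem_dualMonoid (hgf p) (hg q) (hgf q)
  have hne : ∀ p, Δ.torusFunction K hbot (f * torusChar K (-m p)) ≠ 0 := fun p =>
    Δ.torusFunction_ne_zero _ (mul_ne_zero hf0 (isUnit_torusChar K (-m p)).ne_zero)
  let a : ∀ p : C, (Δ.toricScheme K).presheaf.stalk (i p) := fun p =>
    Δ.chartGerm K (σ p) (hmem p) (coneChar K ⟨m η - m p, hsub p η⟩)
  have ha : ∀ p, algebraMap _ (Δ.toricScheme K).functionField (a p) =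
      Δ.torusFunction K hbot (torusChar K (m η - m p)) := fun p => by
    rw [Δ.algebraMap_chartGerm K hbot, coneRingMap_coneChar]; rfl
  have hanz : ∀ p, i.stalkMap p (a p) ≠ 0 := by
    intro p h0
    have hspec : η ⤳ p := genericPoint_specializes p
    -- The generic point of `C` is in both charts, where the quotient of the equations is a unit.
    let u := (Δ.toricScheme K).presheaf.stalkSpecializes (i.base.hom.map_specializes hspec) (a p)
    have hu : IsUnit u := by
      refine IsUnit.of_mul_eq_one
        (Δ.chartGerm K (σ η) (hmem η) (coneChar K ⟨m p - m η, hsub η p⟩)) ?_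
      apply IsFractionRing.injective ((Δ.toricScheme K).presheaf.stalk (i η))
        (Δ.toricScheme K).functionField
      rw [map_mul, map_one, algebraMap_stalkSpecializes, ha, Δ.algebraMap_chartGerm K hbot,
        coneRingMap_coneChar]
      change Δ.torusFunction K hbot (torusChar K (m η - m p)) *
        Δ.torusFunction K hbot (torusChar K (m p - m η)) = 1
      rw [← map_mul, ← torusChar_add, sub_add_sub_cancel, sub_self, torusChar_zero, map_one]
    have h1 := Scheme.Hom.stalkSpecializes_stalkMap_apply i η p hspec (a p)
    rw [h0, map_zero] at h1
    exact (hu.map (i.stalkMap η).hom).ne_zero h1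
  refine ⟨_, ⟨1, Δ.torusFunction K hbot (f * torusChar K (-m η)), a, fun _ => 1, one_pos, hne η,
    fun p => ⟨hanz p, by rw [map_one]; exact one_ne_zero, ?_⟩, by rw [Nat.cast_one, one_mul]⟩, ?_⟩
  · rw [ha, map_one, div_one, ← map_mul]
    have h1 : f * torusChar K (-m η) * torusChar K (m η - m p) = f * torusChar K (-m p) := by
      rw [mul_assoc, ← torusChar_add]
      congr 2
      abel
    rw [h1]
    exact isLocalEquation_one (hne p) (heq p) (hmem p)
  · refine Int.cast_nonneg (finsum_nonneg fun p => mul_nonneg ?_ (Int.natCast_nonneg _))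
    rw [map_one, Ring.ord_one, ENat.toNat_zero, Nat.cast_zero, sub_zero]
    exact Int.natCast_nonneg _

/-! ### Toric divisors and the torus-fixed points -/

variable (Δ K)

lemma mem_orbitClosure_of_specializes {σ : Δ.ConeIndex}
    {y : Spec (CommRingCat.of (ConeRing K σ.1))} (hy : y ∈ Δ.chartOrbit K σ)
    {x : Δ.toricScheme K} (hx : Δ.chart K σ y ⤳ x) : x ∈ Δ.orbitClosure K σ :=
  closure_mono (Set.singleton_subset_iff.2 (Set.mem_image_of_mem _ hy)) hx.mem_closure

/-- The generic point of the orbit of a face of `σ` specializes to the torus-fixed point of `σ`. -/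
lemma fixedPoint_mem_orbitClosure {ρ σ : Δ.ConeIndex} (hσ : coneDim σ.1 = n) (h : ρ ≤ σ) :
    Δ.fixedPoint K σ hσ ∈ Δ.orbitClosure K ρ := by
  -- The characters in `ρ^∨ ∩ ρ^⊥`.
  let F : AddSubmonoid (dualMonoid ρ.1) :=
    { carrier := {m | ∀ v ∈ ρ.1, latticePairing (m : Fin n → ℤ) v = 0}
      zero_mem' := fun v _ => by simp [latticePairing]
      add_mem' := fun {a b} ha hb v hv => by
        change latticePairing (a.1 + b.1) v = 0
        rw [latticePairing_add_left, ha v hv, hb v hv, add_zero] }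
  have hF : ∀ a b, a + b ∈ F → a ∈ F ∧ b ∈ F := by
    intro a b hab
    have h1 : ∀ v ∈ ρ.1, latticePairing a.1 v + latticePairing b.1 v = 0 := fun v hv => by
      rw [← latticePairing_add_left]; exact hab v hv
    constructor <;> intro v hv <;> have h2 := h1 v hv <;> have h3 := a.2 v hv <;>
      have h4 := b.2 v hv <;> linarith
  let y := Δ.primePoint K ρ (faceIdeal F hF)
  have hy : y ∈ Δ.chartOrbit K ρ := by
    rintro _ ⟨m, ⟨v, hv, hmv⟩, rfl⟩
    refine mem_faceIdeal.2 fun a ha => ?_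
    rw [coneChar, AddMonoidAlgebra.coeff_single, Finsupp.single_eq_of_ne]
    rintro rfl
    exact hmv (ha v hv)
  refine Δ.mem_orbitClosure_of_specializes K hy ?_
  rw [← Δ.chart_specMap K h, fixedPoint, chart_specializes_iff]
  intro x hx
  have hx' : coneRingMap K h x ∈ faceIdeal F hF := hx
  have h1 := coeff_coneRingMap K h x 0
  rw [map_zero] at h1
  rw [mem_fixedPrime, ← h1]
  exact mem_faceIdeal.1 hx' 0 F.zero_mem

/-- The closure of the orbit of `ρ` meets only the charts of the cones that contain `ρ`. -/
lemma le_of_mem_orbitClosure {ρ τ : Δ.ConeIndex} {x : Δ.toricScheme K}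
    (hx : x ∈ Δ.orbitClosure K ρ) (hτ : x ∈ Δ.chartOpen K τ) : ρ ≤ τ := by
  obtain ⟨_, hz, y, hy, rfl⟩ := mem_closure_iff.1 hx _ (Δ.chartOpen K τ).isOpen hτ
  obtain ⟨z, hz⟩ := Δ.mem_chartOpen.1 hz
  obtain ⟨κ, hκρ, hκτ, w, rfl⟩ := Δ.exists_specMap_eq_of_chart_eq K hz.symm
  obtain ⟨m, hm, hface⟩ := Δ.isConeFace_of_le κ.2 ρ.2 hκρ
  by_contra hle
  obtain ⟨v, hv, hmv⟩ : ∃ v ∈ ρ.1, latticePairing m v ≠ 0 := by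
    by_contra! h0
    exact hle fun v hv => hκτ ((hface v).2 ⟨hv, h0 v hv⟩)
  have h1 : coneChar K ⟨m, hm⟩ ∈
      (Spec.map (CommRingCat.ofHom (coneRingMap K hκρ)) w).asIdeal :=
    hy ⟨⟨m, hm⟩, ⟨v, hv, hmv⟩, rfl⟩
  have h2 := (Δ.range_chartDiagram_map K (homOfLE hκρ) hm hface).le ⟨w, rfl⟩
  exact h2 h1

/-- On the chart of `σ`, the closure of the orbit of a face `ρ` is contained in the zero locus of
the characters that are not trivial on `ρ`. -/
lemma coneChar_mem_of_mem_orbitClosure {ρ σ : Δ.ConeIndex} (h : ρ ≤ σ)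
    {y : Spec (CommRingCat.of (ConeRing K σ.1))} (hy : Δ.chart K σ y ∈ Δ.orbitClosure K ρ)
    {m : dualMonoid σ.1} {v : Fin n → ℝ} (hv : v ∈ ρ.1)
    (hmv : latticePairing (m : Fin n → ℤ) v ≠ 0) : coneChar K m ∈ y.asIdeal := by
  by_contra hm
  have hopen : IsOpen (Δ.chart K σ '' (PrimeSpectrum.basicOpen (coneChar K m) :
      Set (PrimeSpectrum (ConeRing K σ.1)))) :=
    (Δ.chart K σ).isOpenEmbedding.isOpenMap _ (PrimeSpectrum.basicOpen _).isOpen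
  obtain ⟨_, ⟨w, hw, rfl⟩, z, hz, hzw⟩ := mem_closure_iff.1 hy _ hopen ⟨y, hm, rfl⟩
  rw [← Δ.chart_specMap K h] at hzw
  obtain rfl := Δ.chart_injective K σ hzw
  refine hw ?_
  change coneRingMap K h (coneChar K m) ∈ z.asIdeal
  rw [coneRingMap_coneChar]
  exact hz ⟨_, ⟨v, hv, hmv⟩, rfl⟩

lemma interRayDivisors_eq (hsimp : Δ.IsSimplicial) (hcompl : Δ.IsComplete) {σ : Δ.ConeIndex}
    (hσ : coneDim σ.1 = n) : Δ.interRayDivisors K σ.1 = {Δ.fixedPoint K σ hσ} := by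
  have hsup := (hsimp σ.1 σ.2).1
  refine Set.eq_singleton_iff_unique_mem.2 ⟨Set.mem_iInter.2 fun ρ =>
    Δ.fixedPoint_mem_orbitClosure K hσ ρ.2.2, fun x hx => ?_⟩
  rw [interRayDivisors, Set.mem_iInter] at hx
  have hray : ∀ ρ ∈ Δ.raysOf σ.1, ∃ hρ : ρ ∈ Δ.cones, x ∈ Δ.orbitClosure K ⟨ρ, hρ⟩ :=
    fun ρ hρ => ⟨hρ.1.1, hx ⟨⟨ρ, hρ.1.1⟩, hρ⟩⟩
  obtain ⟨τ, hτ, hxτ⟩ := Δ.exists_mem_chartOpen K hcompl x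
  have hle : σ.1 ≤ τ.1 := by
    rw [← hsup]
    refine sSup_le fun ρ hρ => ?_
    obtain ⟨hρ', hxρ⟩ := hray ρ hρ
    exact Δ.le_of_mem_orbitClosure K hxρ hxτ
  obtain rfl : σ = τ := Subtype.ext (Δ.eq_of_le_of_coneDim_eq ⟨σ.2, hσ⟩ τ.2 hle)
  obtain ⟨y, rfl⟩ := Δ.mem_chartOpen.1 hxτ
  have hmax : (Δ.fixedPrime K σ hσ).asIdeal.IsMaximal :=
    RingHom.ker_isMaximal_of_surjective (constantCoeff K hσ) fun r =>
      ⟨algebraMap K _ r, congr($(constantCoeff_comp_algebraMap K hσ) r)⟩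
  have hyle : (Δ.fixedPrime K σ hσ).asIdeal ≤ y.asIdeal := by
    refine fun a ha => mem_of_forall_single_mem fun m hm => ?_
    have hm0 : m ≠ 0 := by
      rintro rfl
      exact hm (Δ.mem_fixedPrime.1 ha)
    -- A nonzero character is not trivial on all the rays of `σ`.
    obtain ⟨ρ, hρ, v, hv, hmv⟩ : ∃ ρ ∈ Δ.raysOf σ.1, ∃ v ∈ ρ, latticePairing m.1 v ≠ 0 := by
      by_contra! h0
      refine hm0 (Subtype.ext (eq_zero_of_latticePairing_eq_zero hσ fun v hv => ?_))
      let Z : PointedCone ℝ (Fin n → ℝ) :=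
        { carrier := {v | latticePairing m.1 v = 0}
          zero_mem' := latticePairing_zero_right _
          add_mem' := fun {a b} ha hb => by
            change latticePairing m.1 (a + b) = 0
            rw [latticePairing_add_right, show latticePairing m.1 a = 0 from ha,
              show latticePairing m.1 b = 0 from hb, add_zero]
          smul_mem' := fun c a ha => by
            change latticePairing m.1 ((c : ℝ) • a) = 0
            rw [latticePairing_smul_right, show latticePairing m.1 a = 0 from ha, mul_zero] }
      have hZ : σ.1 ≤ Z := by
        rw [← hsup]; exact sSup_le fun ρ hρ v hv => h0 ρ hρ v hv
      exact hZ hv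
    obtain ⟨hρ', hxρ⟩ := hray ρ hρ
    exact Δ.coneChar_mem_of_mem_orbitClosure K (ρ := ⟨ρ, hρ'⟩) hρ.2 hxρ hv hmv
  have heq : Δ.fixedPrime K σ hσ = y :=
    PrimeSpectrum.ext (hmax.eq_of_le (PrimeSpectrum.isPrime y).ne_top hyle)
  rw [fixedPoint, heq]

/-! ### Rationality over the integers -/

/-- The section `Spec R ⟶ X_Δ` given by the torus-fixed point of a full-dimensional cone. -/
def fixedSection (R : Type u) [CommRing R] {σ : Δ.ConeIndex} (hσ : coneDim σ.1 = n) :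
    Spec (CommRingCat.of R) ⟶ Δ.toricScheme R :=
  Spec.map (CommRingCat.ofHom (constantCoeff R hσ)) ≫ Δ.chart R σ

lemma fixedSection_structureMap (R : Type u) [CommRing R] {σ : Δ.ConeIndex}
    (hσ : coneDim σ.1 = n) : Δ.fixedSection R hσ ≫ Δ.structureMap R = 𝟙 _ := by
  have h1 : Δ.chart R σ ≫ Δ.structureMap R =
      Spec.map (CommRingCat.ofHom (algebraMap R (ConeRing R σ.1))) := colimit.ι_desc _ _
  rw [fixedSection, Category.assoc, h1, ← Spec.map_comp, ← CommRingCat.ofHom_comp,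
    constantCoeff_comp_algebraMap]
  exact Spec.map_id _

lemma fixedSection_baseChangeMap {R R' : Type u} [CommRing R] [CommRing R'] (φ : R →+* R')
    {σ : Δ.ConeIndex} (hσ : coneDim σ.1 = n) :
    Δ.fixedSection R' hσ ≫ Δ.baseChangeMap φ =
      Spec.map (CommRingCat.ofHom φ) ≫ Δ.fixedSection R hσ := by
  have h1 : Δ.chart R' σ ≫ Δ.baseChangeMap φ =
      Spec.map (CommRingCat.ofHom (AddMonoidAlgebra.mapRingHom (dualMonoid σ.1) φ)) ≫
        Δ.chart R σ := ι_colimMap _ _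
  have h2 : (constantCoeff R' hσ).comp (AddMonoidAlgebra.mapRingHom (dualMonoid σ.1) φ) =
      φ.comp (constantCoeff R hσ) := by
    refine RingHom.ext fun x => ?_
    rw [RingHom.comp_apply, RingHom.comp_apply, constantCoeff_apply, constantCoeff_apply]
    simp
  rw [fixedSection, fixedSection, Category.assoc, h1, ← Category.assoc, ← Spec.map_comp,
    ← CommRingCat.ofHom_comp, h2, CommRingCat.ofHom_comp, Spec.map_comp, Category.assoc]

lemma range_fixedSection {σ : Δ.ConeIndex} (hσ : coneDim σ.1 = n) :
    Set.range (Δ.fixedSection K hσ) = {Δ.fixedPoint K σ hσ} := by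
  have h1 : ∀ y, Δ.fixedSection K hσ y = Δ.fixedPoint K σ hσ := by
    intro y
    have h2 : Spec.map (CommRingCat.ofHom (constantCoeff K hσ)) y = Δ.fixedPrime K σ hσ := by
      have hy : y = (⊥ : PrimeSpectrum K) := Subsingleton.elim (α := PrimeSpectrum K) _ _
      rw [hy]
      exact PrimeSpectrum.ext rfl
    rw [fixedPoint, ← h2]; rfl
  refine Set.eq_singleton_iff_unique_mem.2 ⟨⟨(⊥ : PrimeSpectrum K), h1 _⟩, ?_⟩
  rintro _ ⟨y, rfl⟩
  exact h1 y

lemma isIntegerRational_fixedPoint {σ : Δ.ConeIndex} (hσ : coneDim σ.1 = n) :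
    Δ.IsIntegerRational K (Δ.fixedPoint K σ hσ) :=
  ⟨Δ.fixedSection _ hσ, Δ.fixedSection K hσ, Δ.fixedSection_structureMap _ hσ,
    Δ.fixedSection_structureMap K hσ, Δ.fixedSection_baseChangeMap _ hσ, Δ.range_fixedSection K hσ⟩

end ToricFan

end

theorem proposition3p2 {K : Type u} [Field K] {n : ℕ} (Δ : ToricFan n)
    (hsimp : Δ.IsSimplicial) (hcompl : Δ.IsComplete)
    (D : WeilDivisor (Δ.toricScheme K)) (hD : D.IsEffective)
    (h : ¬ D.IsNef (Δ.structureMap K) ∨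
      (TorsionPrimeToChar K (Δ.toricScheme K) ∧ ¬ D.IsCartier)) :
    ∃ σ ∈ Δ.conesOfDim n, ∃ γ : Δ.toricScheme K,
      Δ.interRayDivisors K σ = {γ} ∧ γ ∈ D.support ∧ Δ.IsIntegerRational K γ := by
  by_contra hno
  have hfix : ∀ (σ : Δ.ConeIndex) (hσ : coneDim σ.1 = n), Δ.fixedPoint K σ hσ ∉ D.support :=
    fun σ hσ hmem => hno ⟨σ.1, ⟨σ.2, hσ⟩, Δ.fixedPoint K σ hσ,
      Δ.interRayDivisors_eq K hsimp hcompl hσ, hmem, Δ.isIntegerRational_fixedPoint K hσ⟩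
  rcases h with h | ⟨-, h⟩
  · exact h (ToricFan.isNef_of_fixedPoint_notMem hcompl hD hfix)
  · exact h (ToricFan.isCartier_of_fixedPoint_notMem hcompl hD hfix)
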